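/- **Setting.** There are $N$ episodes of $T$ steps; $(t,i)$ is step $t$ of episode $i$, and all steps are also ordered on one time line of length $NT$ (so $(0,i)=(T,i-1)$, and so on). The losses $f_{t,i}:\mathbb R^d\to\mathbb R$ are convex quadratic, and $\beta,b\ge 0$, $\kappa\ge 1$, $\gamma\in(0,1)$, $\delta\in(0,\frac12]$, $\eta\in(0,1]$, $L\ge 1$ with $T\ge 10L$. (1) $\|\nabla f_{t,i}(x)\|\le 2\beta\|x\|+b$ for all $x,t,i$. (2) The starting points satisfy $\|x_{1,i}\|\le R$ for all $i$. *Normalization.* Let $\beta_0=\frac{\gamma(1-\gamma)^2}{10^3\kappa^5L^2}$, let $s=1$ if $\beta\le\beta_0$ and $s=\beta_0/\beta$ otherwise, and let $F_{t,i}=s f_{t,i}$, with Hessian $H_{t,i}$. The algorithm and the dynamical system below are those of the normalized losses $F_{t,i}$ (so those of $f_{t,i}$ itself when $\beta\le\beta_0$). *System.* On $\mathbb R^{3d}$ let $$A_{t,i}=\begin{bmatrix}(1-\delta)I&0&-\eta I\\ I&0&0\\ H_{t,i}&-H_{t,i}&0\end{bmatrix},\qquad B=\begin{bmatrix}I&0&0\\0&0&0\\0&0&0\end{bmatrix}.$$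 (3) The system is $(\kappa,\gamma)$ sequentially stable: for every interval $I$ of consecutive times in the time line of length $NT$, the (time-ordered) product of the matrices $A$ over $I$ has operator norm at most $\kappa^2(1-\gamma)^{|I|}$. *Algorithm (gradient perturbation controller).* Let $\mathcal M$ be the set of $M=(M^1,\dots,M^L)$, $M^l\in\mathbb R^{3d\times 3d}$, with $\|M^l\|\le\kappa^3(1-\gamma)^l$. Start from $z_{1,1}=(x_{1,1},x_{1,1},0)$ and any $M_{1,1}\in\mathcal M$. At each time play $u_{t,i}=\sum_{l=1}^L M_{t,i}^l w_{t-l,i}$ and move to $z_{t+1,i}=A_{t,i}z_{t,i}+Bu_{t,i}+w_{t,i}$ along the time line, where $w=0$ before time $(1,1)$. Write $x_{t,i}$ and $x_{t-1,i}$ for the first and second blocks of $z_{t,i}$. The disturbance is $w_{t,i}=(0,0,\nabla F_{t,i}(x_{t-1,i}))$ for $t<T$. At $t=T$, $i<N$, it is the reset disturbance $$w_{T,i}=\begin{bmatrix}x_{1,i+1}-((1-\delta)x_{T,i}-\eta\nabla F_{T-1,i}(x_{T-1,i})+\bar u_{T,i})\\ x_{1,i+1}-x_{T,i}\\ \nabla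 F_{T,i}(x_{T-1,i})-\nabla F_{T,i}(x_{T,i})\end{bmatrix}$$ with $\bar u$ the first block of $u$; it makes the next episode start at $(x_{1,i+1},x_{1,i+1},0)$. Then update $M_{t+1,i}=\Pi_{\mathcal M}\big(M_{t,i}-\eta_g\nabla g_{t,i}(M_{t,i})\big)$ (Euclidean projection and gradient). Here $g_{t,i}(M)$ is the value of $F_{t,i}$ at the first block of the surrogate state: the state reached at time $(t,i)$ on the recorded disturbances when the state $L$ steps earlier is $0$ and the fixed $M$ is played since then (if fewer than $L$ steps have passed, starting from $0$ at time $(1,1)$). *Comparator.* For $M\in\mathcal M$ let $x^M_{t,i}$ be the first block of the state at time $(t,i)$ when the fixed disturbance-feedback controller $u_{t,i}=\sum_{l=1}^L M^lw_{t-l,i}$ is played at all times from $z_{1,1}$ on the same matrices $A_{t,i}$ and the same disturbances $w_{t,i}$ (reset disturbances included) as occurred in the run of the algorithm. Let $$\text{meta-regret}=\sum_{i=1}^N\sum_{t=1}^T f_{t,i}(x_{t,i})-\min_{M\in\mathcal M}\sum_{i=1}^N\sum_{t=1}^T f_{t,i}(x^M_{t,i}).$$ **Theorem.** There are universal polynomials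 $p,P$ and a universal $q\in\mathbb N$ such that, in the above setting, for all $a_1>0$, $a_2,\Lambda\in\mathbb R$: if $$p(\gamma^{-1},\beta,\kappa,R,b,d)\,\log(NT)\le L\le\Lambda\log(NT),\qquad \frac{a_1}{\sqrt{NT}}\le\eta_g\le\frac{a_2}{\sqrt{NT}},$$ then the minimum in the meta-regret is attained and every run of the algorithm satisfies $$\text{meta-regret}\le P(\gamma^{-1},\beta,\kappa,R,b,d,\Lambda,a_1^{-1},a_2)\,\log^q(NT)\,\sqrt{NT}.$$ -/

import Mathlib

namespace MetaOpt

/-- The space `ℝ^d` of optimization iterates, with the Euclidean norm. -/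
abbrev Point (d : ℕ) := EuclideanSpace ℝ (Fin d)

/-- The space `ℝ^{3d}` of system states, controls and disturbances, with the Euclidean norm; the
coordinate `(r, j)` is the `j`-th coordinate of the `r`-th block of size `d`. -/
abbrev State (d : ℕ) := EuclideanSpace ℝ (Fin 3 × Fin d)

/-- Controller parameters `M = (M^1, …, M^L)`, each `M^l` a `3d × 3d` matrix, with the Euclidean
(Frobenius) inner product. -/
abbrev Policy (d L : ℕ) := EuclideanSpace ℝ (Fin L × (Fin 3 × Fin d) × (Fin 3 × Fin d))

/-- The `r`-th block of a state. -/
def block {d : ℕ} (z : State d) (r : Fin 3) : Point d := WithLp.toLp 2 fun j => z (r, j)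

/-- The state with blocks `x`, `y`, `g`. -/
def mkState {d : ℕ} (x y g : Point d) : State d := WithLp.toLp 2 fun p => ![x, y, g] p.1 p.2

/-- `f(x) = ½ xᵀ H x + qᵀ x + c` with `H` symmetric positive semidefinite. -/
def IsConvexQuadratic {d : ℕ} (f : Point d → ℝ) : Prop :=
  ∃ (H : Point d →L[ℝ] Point d) (q : Point d) (c : ℝ), H.IsPositive ∧
    ∀ x, f x = 1 / 2 * inner ℝ x (H x) + inner ℝ q x + c

/-- The Hessian of a quadratic function (it does not depend on the base point). -/
noncomputable def hessian {d : ℕ} (f : Point d → ℝ) : Point d →L[ℝ] Point d :=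
  fderiv ℝ (gradient f) 0

/-- The dynamics matrix with block rows `[(1-δ)I, 0, -ηI]`, `[I, 0, 0]`, `[H, -H, 0]`. -/
noncomputable def dynOp {d : ℕ} (δ η : ℝ) (H : Point d →L[ℝ] Point d) :
    State d →L[ℝ] State d :=
  LinearMap.toContinuousLinearMap
    { toFun := fun z => mkState ((1 - δ) • block z 0 - η • block z 2) (block z 0)
        (H (block z 0) - H (block z 1))
      map_add' := by
        intro z z'
        have hb : ∀ r, block (z + z') r = block z r + block z' r := fun r => rfl
        ext ⟨r, j⟩
        fin_cases r <;> simp [mkState, hb] <;> ring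
      map_smul' := by
        intro c z
        have hb : ∀ r, block (c • z) r = c • block z r := fun r => rfl
        ext ⟨r, j⟩
        fin_cases r <;> simp [mkState, hb] <;> ring }

/-- The control-input matrix `diag(I, 0, 0)`, applied to a control. -/
def inputMap {d : ℕ} (u : State d) : State d := mkState (block u 0) 0 0

/-- The matrix `M^{l+1}` of a policy, as an operator; its norm is the spectral norm. -/
noncomputable def Policy.op {d L : ℕ} (M : Policy d L) (l : Fin L) : State d →L[ℝ] State d :=
  Matrix.toEuclideanCLM (𝕜 := ℝ) (Matrix.of fun p q => M (l, p, q))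

/-- The set `𝓜 = {M : ‖M^l‖ ≤ κ³ (1-γ)^l, l = 1, …, L}`. -/
def policySet (d L : ℕ) (κ γ : ℝ) : Set (Policy d L) :=
  {M | ∀ l : Fin L, ‖Policy.op M l‖ ≤ κ ^ 3 * (1 - γ) ^ ((l : ℕ) + 1)}

/-- The disturbance-feedback control `u_k = ∑_{l=1}^L M^l w_{k-l}`, where `w_j = 0` for `j < 0`. -/
noncomputable def dfcControl {d L : ℕ} (M : Policy d L) (w : ℕ → State d) (k : ℕ) : State d :=
  ∑ l : Fin L, if (l : ℕ) + 1 ≤ k then Policy.op M l (w (k - ((l : ℕ) + 1))) else 0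

/-- The state at time `s + n` of the system `z_{k+1} = A_k z_k + B u_k + w_k` started from
`z_s = z₀`. -/
def evolve {d : ℕ} (A : ℕ → State d →L[ℝ] State d) (u w : ℕ → State d) (z₀ : State d) (s : ℕ) :
    ℕ → State d
  | 0 => z₀
  | n + 1 => A (s + n) (evolve A u w z₀ s n) + inputMap (u (s + n)) + w (s + n)

/-- The state at time `k` when the fixed controller `M` is played at all times from the initial
state `z₀`, on the disturbance sequence `w`. -/
noncomputable def dfcState {d L : ℕ} (A : ℕ → State d →L[ℝ] State d) (w : ℕ → State d)
    (z₀ : State d) (M : Policy d L) (k : ℕ) : State d :=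
  evolve A (dfcControl M w) w z₀ 0 k

/-- The surrogate state at time `k`: the state reached at time `k` if the state at time `k - L` is
`0` and the fixed controller `M` is played during the last `L` steps. If `k < L` the system is at
rest at `0` until time `0`, since there are no disturbances before time `0`. -/
noncomputable def surrogateState {d L : ℕ} (A : ℕ → State d →L[ℝ] State d) (w : ℕ → State d)
    (M : Policy d L) (k : ℕ) : State d :=
  evolve A (dfcControl M w) w 0 (k - L) (min L k)

/-- The product `A_{r+n-1} ⋯ A_{r+1} A_r`. -/
noncomputable def transProd {d : ℕ} (A : ℕ → State d →L[ℝ] State d) (r : ℕ) :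
    ℕ → State d →L[ℝ] State d
  | 0 => ContinuousLinearMap.id ℝ (State d)
  | n + 1 => (A (r + n)).comp (transProd A r n)

/-- `(κ, γ)` sequential stability over the times `0, …, n - 1`: the product of the dynamics
matrices over every nonempty interval `I` of times has norm at most `κ² (1-γ)^{|I|}`. -/
def SequentiallyStable {d : ℕ} (A : ℕ → State d →L[ℝ] State d) (n : ℕ) (κ γ : ℝ) : Prop :=
  ∀ r m : ℕ, 1 ≤ m → r + m ≤ n → ‖transProd A r m‖ ≤ κ ^ 2 * (1 - γ) ^ m

/-- `q` is the Euclidean projection of `p` onto `S`. -/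
def IsProjection {E : Type*} [NormedAddCommGroup E] (S : Set E) (p q : E) : Prop :=
  q ∈ S ∧ ∀ q' ∈ S, ‖p - q‖ ≤ ‖p - q'‖

/-- The dynamics matrices of the losses `F 0, F 1, …`. -/
noncomputable def dynamics {d : ℕ} (δ η : ℝ) (F : ℕ → Point d → ℝ) (k : ℕ) :
    State d →L[ℝ] State d :=
  dynOp δ η (hessian (F k))

/-- The reset disturbance at the last step `k` of an episode, at state `z` under control `u`, when
the next episode starts from `x'`. The first two blocks of `z` are the current and the previous
iterate. -/
noncomputable def resetDisturbance {d : ℕ} (δ η : ℝ) (F : ℕ → Point d → ℝ) (k : ℕ)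
    (z u : State d) (x' : Point d) : State d :=
  mkState
    (x' - ((1 - δ) • block z 0 - η • gradient (F (k - 1)) (block z 1) + block u 0))
    (x' - block z 0)
    (gradient (F k) (block z 1) - gradient (F k) (block z 0))

/-- Runs of the gradient perturbation controller for meta-optimization with `N` episodes of `T`
steps. Times are numbered consecutively: step `t` of episode `i` (both counted from `0`) is time
`k = i * T + t`; `F k` is the loss at time `k`, and `x₁ i` the starting point of episode `i`. The
sequences `z`, `w`, `M` are the states, the disturbances and the controller parameters. -/
structure IsGPCRun {d L : ℕ} (N T : ℕ) (δ η ηg κ γ : ℝ) (x₁ : ℕ → Point d)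
    (F : ℕ → Point d → ℝ) (z w : ℕ → State d) (M : ℕ → Policy d L) : Prop where
  state_zero : z 0 = mkState (x₁ 0) (x₁ 0) 0
  policy_zero : M 0 ∈ policySet d L κ γ
  state_succ : ∀ k, k + 1 < N * T →
    z (k + 1) = dynamics δ η F k (z k) + inputMap (dfcControl (M k) w k) + w k
  disturbance : ∀ k, k + 1 < N * T → ¬ T ∣ k + 1 →
    w k = mkState 0 0 (gradient (F k) (block (z k) 1))
  disturbance_reset : ∀ k, k + 1 < N * T → T ∣ k + 1 →
    w k = resetDisturbance δ η F k (z k) (dfcControl (M k) w k) (x₁ ((k + 1) / T))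
  policy_succ : ∀ k, k + 1 < N * T →
    IsProjection (policySet d L κ γ)
      (M k - ηg • gradient
        (fun M' : Policy d L => F k (block (surrogateState (dynamics δ η F) w M' k) 0)) (M k))
      (M (k + 1))

/-- The normalization level `β₀ = γ (1-γ)² / (10³ κ⁵ L²)`. -/
noncomputable def betaZero (κ γ : ℝ) (L : ℕ) : ℝ :=
  γ * (1 - γ) ^ 2 / (10 ^ 3 * κ ^ 5 * (L : ℝ) ^ 2)

open Classical in
/-- The factor by which losses with smoothness parameter `β` are normalized: `1` if `β ≤ β₀`, and
`β₀ / β` otherwise. -/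
noncomputable def lossScale (β κ γ : ℝ) (L : ℕ) : ℝ :=
  if β ≤ betaZero κ γ L then 1 else betaZero κ γ L / β

/-- The normalized losses, numbered by time; `f t i` is the loss at step `t` of episode `i`. -/
noncomputable def normalizedLoss {d : ℕ} (T L : ℕ) (β κ γ : ℝ) (f : ℕ → ℕ → Point d → ℝ) (k : ℕ)
    (x : Point d) : ℝ :=
  lossScale β κ γ L * f (k % T) (k / T) x

/-- The total loss `∑_i ∑_t f_{t,i}(x_{t,i})` of a state sequence, the iterate `x_{t,i}` being the
first block of the state at step `t` of episode `i`. -/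
noncomputable def totalCost {d : ℕ} (N T : ℕ) (f : ℕ → ℕ → Point d → ℝ) (z : ℕ → State d) : ℝ :=
  ∑ i ∈ Finset.range N, ∑ t ∈ Finset.range T, f t i (block (z (i * T + t)) 0)

end MetaOpt

namespace MetaOpt

/-! ### Blocks, policies as operators, and the geometry of the policy set -/

variable {d L : ℕ}

/-! Once the recorded disturbances are fixed, the state reached under a fixed policy is affine in
that policy. The surrogate losses are therefore convex in `M`, and the controller is projected
online gradient descent on them. `regret_le` adds three errors: actual state versus surrogate under
the current policy (policies move slowly and the system forgets), the descent regret of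
`sum_inner_le_of_isProjection`, and surrogate versus comparator (forgetting alone). Forgetting costs
`(1 - γ) ^ L ≤ 1 / n` per step, where `n = N * T`, because `L ≥ γ⁻¹ log n`.

All this needs bounded states and disturbances, which is the delicate point: a reset disturbance is
as large as the state, which earlier resets have fed. `trajectory_bounds` breaks the circle.
Ordinary disturbances stay small because normalization makes the gradients nearly insensitive to the
state, and between two resets there is time for the effect of the first to decay before the second
is formed.

The regret is measured on the original losses while the run uses losses scaled by `s`. Scaling a
loss is the same as scaling the step size, so the argument is applied to the original losses with
step `ηg * s`. The resulting `1 / s` may grow like `(1 - γ)⁻²`, which is not polynomial in `γ⁻¹`;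
the squared diameter of the policy set carries a factor `(1 - γ) ^ 2` that cancels it
(`sq_div_lossScale_le`). -/

theorem norm_block_le (z : State d) (r : Fin 3) : ‖block z r‖ ≤ ‖z‖ := by
  refine le_of_sq_le_sq ?_ (norm_nonneg _)
  rw [EuclideanSpace.norm_sq_eq, EuclideanSpace.norm_sq_eq, Fintype.sum_prod_type]
  exact Finset.single_le_sum (f := fun r => ∑ j, ‖z (r, j)‖ ^ 2)
    (fun r _ => Finset.sum_nonneg fun j _ => sq_nonneg _) (Finset.mem_univ r)

theorem norm_mkState_sq (x y g : Point d) :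
    ‖mkState x y g‖ ^ 2 = ‖x‖ ^ 2 + ‖y‖ ^ 2 + ‖g‖ ^ 2 := by
  simp only [EuclideanSpace.norm_sq_eq, Fintype.sum_prod_type, Fin.sum_univ_three]
  rfl

theorem norm_mkState_le (x y g : Point d) : ‖mkState x y g‖ ≤ ‖x‖ + ‖y‖ + ‖g‖ := by
  have := norm_nonneg x
  have := norm_nonneg y
  have := norm_nonneg g
  refine abs_le_of_sq_le_sq' ?_ (by positivity) |>.2
  rw [norm_mkState_sq]
  nlinarith [mul_nonneg (norm_nonneg x) (norm_nonneg y),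
    mul_nonneg (norm_nonneg x) (norm_nonneg g), mul_nonneg (norm_nonneg y) (norm_nonneg g)]

theorem norm_inputMap_le (u : State d) : ‖inputMap u‖ ≤ ‖u‖ := by
  refine (norm_mkState_le _ _ _).trans ?_
  simpa using norm_block_le u 0

/-- Taking the `r`-th block, as a continuous linear map. -/
noncomputable def blockCLM (d : ℕ) (r : Fin 3) : State d →L[ℝ] Point d :=
  LinearMap.toContinuousLinearMap
    { toFun := fun z => block z r
      map_add' := fun _ _ => rfl
      map_smul' := fun _ _ => rfl }

theorem block_sub (z z' : State d) (r : Fin 3) : block (z - z') r = block z r - block z' r := rfl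

/-- The control-input matrix, as a continuous linear map. -/
noncomputable def inputCLM (d : ℕ) : State d →L[ℝ] State d :=
  LinearMap.toContinuousLinearMap
    { toFun := inputMap
      map_add' := by
        intro u v
        ext ⟨r, j⟩
        fin_cases r <;> simp [inputMap, mkState, block]
      map_smul' := by
        intro c u
        ext ⟨r, j⟩
        fin_cases r <;> simp [inputMap, mkState, block] }

@[simp] theorem inputCLM_apply (u : State d) : inputCLM d u = inputMap u := rfl

theorem inputMap_sub (u v : State d) : inputMap (u - v) = inputMap u - inputMap v :=
  map_sub (inputCLM d) u v

@[simp] theorem inputMap_zero : inputMap (0 : State d) = 0 := map_zero (inputCLM d)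

theorem Policy.op_add (M M' : Policy d L) (l : Fin L) :
    Policy.op (M + M') l = Policy.op M l + Policy.op M' l := by
  simp only [Policy.op, ← map_add]; rfl

theorem Policy.op_smul (c : ℝ) (M : Policy d L) (l : Fin L) :
    Policy.op (c • M) l = c • Policy.op M l := by
  simp only [Policy.op, ← map_smul]; rfl

/-- The `l`-th matrix of a policy, as a linear function of the policy. -/
noncomputable def opCLM (d : ℕ) (l : Fin L) : Policy d L →L[ℝ] State d →L[ℝ] State d :=
  LinearMap.toContinuousLinearMap
    { toFun := fun M => Policy.op M l
      map_add' := fun M M' => Policy.op_add M M' l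
      map_smul' := fun c M => Policy.op_smul c M l }

@[simp] theorem opCLM_apply (l : Fin L) (M : Policy d L) : opCLM d l M = Policy.op M l := rfl

theorem Policy.op_sub (M M' : Policy d L) (l : Fin L) :
    Policy.op (M - M') l = Policy.op M l - Policy.op M' l := map_sub (opCLM d l) M M'

theorem Policy.op_apply (M : Policy d L) (l : Fin L) (v : State d) (p : Fin 3 × Fin d) :
    Policy.op M l v p = ∑ q, M (l, p, q) * v q := by
  simp [Policy.op, Matrix.mulVec, dotProduct]

/-- Spectral norm is at most Frobenius norm, by Cauchy–Schwarz in each row. -/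
theorem Policy.norm_op_le (M : Policy d L) (l : Fin L) : ‖Policy.op M l‖ ≤ ‖M‖ := by
  refine ContinuousLinearMap.opNorm_le_bound _ (norm_nonneg _) fun v => ?_
  refine abs_le_of_sq_le_sq' ?_ (by positivity) |>.2
  have h : ‖Policy.op M l v‖ ^ 2 ≤ (∑ p, ∑ q, M (l, p, q) ^ 2) * ‖v‖ ^ 2 := by
    rw [EuclideanSpace.norm_sq_eq, EuclideanSpace.norm_sq_eq, Finset.sum_mul]
    refine Finset.sum_le_sum fun p _ => ?_
    rw [Policy.op_apply]
    simp only [Real.norm_eq_abs, sq_abs]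
    exact Finset.sum_mul_sq_le_sq_mul_sq _ _ _
  have hsum : ∑ p, ∑ q, M (l, p, q) ^ 2 =
      ∑ x : (Fin 3 × Fin d) × (Fin 3 × Fin d), M (l, x) ^ 2 :=
    (Fintype.sum_prod_type (f := fun x => M (l, x) ^ 2)).symm
  rw [hsum] at h
  rw [mul_pow]
  refine h.trans (mul_le_mul_of_nonneg_right ?_ (sq_nonneg _))
  rw [EuclideanSpace.norm_sq_eq, Fintype.sum_prod_type (α₁ := Fin L)]
  simp only [Real.norm_eq_abs, sq_abs]
  exact Finset.single_le_sum (f := fun l => ∑ x, M (l, x) ^ 2)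
    (fun r _ => Finset.sum_nonneg fun j _ => sq_nonneg _) (Finset.mem_univ l)

/-- Each column is the image of a unit vector, so its norm is at most `c`; there are `3 * d` columns
in each of `L` matrices. -/
theorem norm_sq_le_of_forall_norm_op_le {M : Policy d L} {c : ℝ}
    (h : ∀ l, ‖Policy.op M l‖ ≤ c) : ‖M‖ ^ 2 ≤ 3 * d * L * c ^ 2 := by
  have key : ∀ l : Fin L, ∀ q, ∑ p, M (l, p, q) ^ 2 ≤ c ^ 2 := by
    intro l q
    have h1 : ‖Policy.op M l (EuclideanSpace.single q 1)‖ ≤ c := by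
      refine ((Policy.op M l).le_opNorm _).trans ?_
      simpa using h l
    have h2 := pow_le_pow_left₀ (norm_nonneg _) h1 2
    rw [EuclideanSpace.norm_sq_eq] at h2
    simpa [Policy.op_apply] using h2
  rw [EuclideanSpace.norm_sq_eq, Fintype.sum_prod_type]
  calc ∑ l, ∑ x, ‖M (l, x)‖ ^ 2 ≤ ∑ _l : Fin L, 3 * d * c ^ 2 := by
        refine Finset.sum_le_sum fun l _ => ?_
        rw [Fintype.sum_prod_type, Finset.sum_comm]
        refine (Finset.sum_le_sum (g := fun _ => c ^ 2) fun q _ => ?_).trans ?_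
        · simpa using key l q
        · simp
    _ = 3 * d * L * c ^ 2 := by simp; ring

theorem convex_policySet (κ γ : ℝ) : Convex ℝ (policySet d L κ γ) := by
  have : policySet d L κ γ =
      ⋂ l : Fin L, opCLM d l ⁻¹' Metric.closedBall 0 (κ ^ 3 * (1 - γ) ^ ((l : ℕ) + 1)) := by
    ext M; simp [policySet]
  rw [this]
  exact convex_iInter fun l => (convex_closedBall _ _).linear_preimage (opCLM d l).toLinearMap

theorem norm_op_le_of_mem_policySet {M : Policy d L} {κ γ : ℝ} (hκ : 1 ≤ κ) (hγ : 0 < γ)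
    (hγ1 : γ < 1) (hM : M ∈ policySet d L κ γ) (l : Fin L) :
    ‖Policy.op M l‖ ≤ κ ^ 3 * (1 - γ) := by
  refine (hM l).trans ?_
  have : (1 - γ) ^ ((l : ℕ) + 1) ≤ (1 - γ) ^ 1 :=
    pow_le_pow_of_le_one (by linarith) (by linarith) (by omega)
  rw [pow_one] at this
  gcongr

theorem isCompact_policySet {κ γ : ℝ} (hκ : 1 ≤ κ) (hγ : 0 < γ) (hγ1 : γ < 1) :
    IsCompact (policySet d L κ γ) := by
  refine Metric.isCompact_of_isClosed_isBounded ?_ ?_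
  · have : policySet d L κ γ =
        ⋂ l : Fin L, opCLM d l ⁻¹' Metric.closedBall 0 (κ ^ 3 * (1 - γ) ^ ((l : ℕ) + 1)) := by
      ext M; simp [policySet]
    rw [this]
    exact isClosed_iInter fun l => Metric.isClosed_closedBall.preimage (opCLM d l).continuous
  · refine isBounded_iff_forall_norm_le.2 ⟨√(3 * d * L * (κ ^ 3 * (1 - γ)) ^ 2), fun M hM => ?_⟩
    exact Real.le_sqrt_of_sq_le
      (norm_sq_le_of_forall_norm_op_le (norm_op_le_of_mem_policySet hκ hγ hγ1 hM))

/-- The factor `(1 - γ) ^ 2` is kept on purpose: it pays for the division by the loss scale in the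
descent bound. -/
theorem norm_sub_sq_le_of_mem_policySet {M M' : Policy d L} {κ γ : ℝ} (hκ : 1 ≤ κ) (hγ : 0 < γ)
    (hγ1 : γ < 1) (hM : M ∈ policySet d L κ γ) (hM' : M' ∈ policySet d L κ γ) :
    ‖M - M'‖ ^ 2 ≤ 12 * d * L * κ ^ 6 * (1 - γ) ^ 2 := by
  refine (norm_sq_le_of_forall_norm_op_le (c := 2 * (κ ^ 3 * (1 - γ))) fun l => ?_).trans_eq
    (by ring)
  rw [Policy.op_sub]
  have h1 := norm_op_le_of_mem_policySet hκ hγ hγ1 hM l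
  have h2 := norm_op_le_of_mem_policySet hκ hγ hγ1 hM' l
  linarith [norm_sub_le (Policy.op M l) (Policy.op M' l)]

/-! ### Controls and states -/

theorem dfcControl_add (M M' : Policy d L) (w : ℕ → State d) (k : ℕ) :
    dfcControl (M + M') w k = dfcControl M w k + dfcControl M' w k := by
  simp only [dfcControl, ← Finset.sum_add_distrib, Policy.op_add]
  refine Finset.sum_congr rfl fun l _ => ?_
  split_ifs <;> simp

theorem dfcControl_smul (c : ℝ) (M : Policy d L) (w : ℕ → State d) (k : ℕ) :
    dfcControl (c • M) w k = c • dfcControl M w k := by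
  simp only [dfcControl, Finset.smul_sum, Policy.op_smul]
  refine Finset.sum_congr rfl fun l _ => ?_
  split_ifs <;> simp

/-- The control played at time `k` on the disturbances `w`, as a linear function of the policy. -/
noncomputable def controlCLM (w : ℕ → State d) (k : ℕ) : Policy d L →L[ℝ] State d :=
  LinearMap.toContinuousLinearMap
    { toFun := fun M => dfcControl M w k
      map_add' := fun M M' => dfcControl_add M M' w k
      map_smul' := fun c M => dfcControl_smul c M w k }

@[simp] theorem controlCLM_apply (w : ℕ → State d) (k : ℕ) (M : Policy d L) :
    controlCLM w k M = dfcControl M w k := rfl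

theorem dfcControl_sub (M M' : Policy d L) (w : ℕ → State d) (k : ℕ) :
    dfcControl (M - M') w k = dfcControl M w k - dfcControl M' w k :=
  map_sub (controlCLM w k) M M'

theorem norm_dfcControl_le {W : ℝ} (hW : 0 ≤ W) (M : Policy d L) {w : ℕ → State d} {k : ℕ}
    (hw : ∀ j < k, ‖w j‖ ≤ W) : ‖dfcControl M w k‖ ≤ L * W * ‖M‖ := by
  have : ∀ l ∈ (Finset.univ : Finset (Fin L)), ‖if (l : ℕ) + 1 ≤ k then
      Policy.op M l (w (k - ((l : ℕ) + 1))) else 0‖ ≤ W * ‖M‖ := by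
    intro l _
    split_ifs with h
    · refine ((Policy.op M l).le_opNorm _).trans ?_
      rw [mul_comm]
      exact mul_le_mul (hw _ (by omega)) (Policy.norm_op_le M l) (norm_nonneg _) hW
    · simp only [norm_zero]; positivity
  refine (norm_sum_le_of_le _ this).trans_eq ?_
  simp; ring

/-- The sum of the first `m` powers of `1 - γ` is at most `1 / γ`. -/
theorem sum_pow_le {γ : ℝ} (hγ : 0 < γ) (hγ1 : γ < 1) (m : ℕ) :
    ∑ j ∈ Finset.range m, (1 - γ) ^ j ≤ γ⁻¹ := by
  have h := geom_sum_eq (x := 1 - γ) (by linarith) m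
  rw [h, show (1 - γ - 1) = -γ by ring, div_neg, ← neg_div, neg_sub, div_eq_mul_inv]
  have : 0 ≤ (1 - γ) ^ m := pow_nonneg (by linarith) m
  have : 0 < γ⁻¹ := inv_pos.2 hγ
  nlinarith

/-- The disturbance `w k` acts like a missing term `l = 0` of weight at most `κ ^ 3`, so control and
disturbance together form one geometric series. -/
theorem norm_dfcControl_add_le {κ γ W : ℝ} (hκ : 1 ≤ κ) (hγ : 0 < γ) (hγ1 : γ < 1) (hW : 0 ≤ W)
    {M : Policy d L} (hM : M ∈ policySet d L κ γ) {w : ℕ → State d} {k : ℕ}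
    (hw : ∀ j ≤ k, k ≤ j + L → ‖w j‖ ≤ W) :
    ‖dfcControl M w k‖ + ‖w k‖ ≤ κ ^ 3 * γ⁻¹ * W := by
  have : ∀ l ∈ (Finset.univ : Finset (Fin L)), ‖if (l : ℕ) + 1 ≤ k then
      Policy.op M l (w (k - ((l : ℕ) + 1))) else 0‖ ≤ κ ^ 3 * (1 - γ) ^ ((l : ℕ) + 1) * W := by
    intro l _
    have : 0 ≤ (1 - γ) ^ ((l : ℕ) + 1) := pow_nonneg (by linarith) _
    split_ifs with h
    · refine ((Policy.op M l).le_opNorm _).trans ?_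
      exact mul_le_mul (hM l) (hw _ (by omega) (by omega)) (norm_nonneg _) (by positivity)
    · simp only [norm_zero]; positivity
  have h1 := norm_sum_le_of_le _ this
  rw [Fin.sum_univ_eq_sum_range (fun l => κ ^ 3 * (1 - γ) ^ (l + 1) * W) L] at h1
  have h2 := sum_pow_le hγ hγ1 (L + 1)
  rw [Finset.sum_range_succ'] at h2
  have h3 : ∑ l ∈ Finset.range L, κ ^ 3 * (1 - γ) ^ (l + 1) * W =
      κ ^ 3 * W * ∑ l ∈ Finset.range L, (1 - γ) ^ (l + 1) := by
    rw [Finset.mul_sum]; exact Finset.sum_congr rfl fun _ _ => by ring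
  rw [h3] at h1
  have h4 : ‖w k‖ ≤ κ ^ 3 * W := (hw k le_rfl (by omega)).trans
    (le_mul_of_one_le_left hW (one_le_pow₀ hκ))
  have h5 : 0 ≤ κ ^ 3 * W := by positivity
  have h6 := mul_le_mul_of_nonneg_left h2 h5
  rw [dfcControl]
  rw [pow_zero] at h6
  linarith

theorem norm_transProd_le {A : ℕ → State d →L[ℝ] State d} {n : ℕ} {κ γ : ℝ}
    (hA : SequentiallyStable A n κ γ) (hκ : 1 ≤ κ) {r m : ℕ} (h : r + m ≤ n) :
    ‖transProd A r m‖ ≤ κ ^ 2 * (1 - γ) ^ m := by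
  rcases Nat.eq_zero_or_pos m with rfl | hm
  · simp only [transProd, pow_zero, mul_one]
    exact ContinuousLinearMap.norm_id_le.trans (one_le_pow₀ hκ)
  · exact hA r m hm h

/-- Variation of constants: the input at time `s + j` passes through the matrices at times `s + j +
1, …, s + m - 1`. -/
theorem recursion_eq {A : ℕ → State d →L[ℝ] State d} {y v : ℕ → State d} {s : ℕ} (m : ℕ)
    (hy : ∀ j < m, y (j + 1) = A (s + j) (y j) + v j) :
    y m = transProd A s m (y 0) +
      ∑ j ∈ Finset.range m, transProd A (s + j + 1) (m - 1 - j) (v j) := by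
  induction m with
  | zero => simp [transProd]
  | succ m ih =>
    rw [hy m (by omega), ih fun j hj => hy j (by omega), Finset.sum_range_succ, map_add, map_sum,
      add_assoc]
    congr 1
    rw [show m + 1 - 1 - m = 0 by omega]
    congr 1
    refine Finset.sum_congr rfl fun j hj => ?_
    rw [Finset.mem_range] at hj
    obtain ⟨i, rfl⟩ : ∃ i, m = j + 1 + i := ⟨m - (j + 1), by omega⟩
    rw [show j + 1 + i + 1 - 1 - j = i + 1 by omega, show j + 1 + i - 1 - j = i by omega,
      transProd, ContinuousLinearMap.comp_apply, show s + (j + 1 + i) = s + j + 1 + i by omega]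

theorem norm_recursion_le {A : ℕ → State d →L[ℝ] State d} {n : ℕ} {κ γ B : ℝ}
    (hA : SequentiallyStable A n κ γ) (hκ : 1 ≤ κ) (hγ : 0 < γ) (hγ1 : γ < 1) (hB : 0 ≤ B)
    {y v : ℕ → State d} {s m : ℕ} (hn : s + m ≤ n)
    (hy : ∀ j < m, y (j + 1) = A (s + j) (y j) + v j) (hv : ∀ j < m, ‖v j‖ ≤ B) :
    ‖y m‖ ≤ κ ^ 2 * (1 - γ) ^ m * ‖y 0‖ + κ ^ 2 * γ⁻¹ * B := by
  rw [recursion_eq m hy]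
  refine (norm_add_le _ _).trans (add_le_add ?_ ?_)
  · exact (ContinuousLinearMap.le_opNorm _ _).trans
      (mul_le_mul_of_nonneg_right (norm_transProd_le hA hκ hn) (norm_nonneg _))
  · have : ∀ j ∈ Finset.range m, ‖transProd A (s + j + 1) (m - 1 - j) (v j)‖ ≤
        κ ^ 2 * (1 - γ) ^ (m - 1 - j) * B := by
      intro j hj
      rw [Finset.mem_range] at hj
      have : 0 ≤ (1 - γ) ^ (m - 1 - j) := pow_nonneg (by linarith) _
      exact (ContinuousLinearMap.le_opNorm _ _).trans
        (mul_le_mul (norm_transProd_le hA hκ (by omega)) (hv j hj) (norm_nonneg _) (by positivity))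
    refine (norm_sum_le_of_le _ this).trans ?_
    rw [Finset.sum_range_reflect (fun j => κ ^ 2 * (1 - γ) ^ j * B) m, ← Finset.sum_mul,
      ← Finset.mul_sum]
    gcongr
    exact sum_pow_le hγ hγ1 m

/-- The disturbances are frozen, so the policy enters only through the controls, and linearly. -/
theorem exists_evolve_eq (A : ℕ → State d →L[ℝ] State d) (w : ℕ → State d) (z₀ : State d)
    (s m : ℕ) : ∃ ℓ : Policy d L →L[ℝ] State d, ∀ M : Policy d L,
      evolve A (dfcControl M w) w z₀ s m = ℓ M + evolve A (dfcControl (0 : Policy d L) w) w z₀ s m := by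
  induction m with
  | zero => exact ⟨0, fun M => by simp [evolve]⟩
  | succ m ih =>
    obtain ⟨ℓ, hℓ⟩ := ih
    refine ⟨(A (s + m)).comp ℓ + (inputCLM d).comp (controlCLM w (s + m)), fun M => ?_⟩
    have h0 : dfcControl (0 : Policy d L) w (s + m) = 0 := map_zero (controlCLM w (s + m))
    simp only [evolve, hℓ M, map_add, _root_.add_apply,
      ContinuousLinearMap.comp_apply, inputCLM_apply, controlCLM_apply, h0, inputMap_zero]
    abel

/-! ### Projected gradient steps -/

/-- By the obtuse-angle characterization of the projection onto a convex set. -/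
theorem IsProjection.norm_sub_le {E : Type*} [NormedAddCommGroup E] [InnerProductSpace ℝ E]
    {K : Set E} (hK : Convex ℝ K) {p q u : E} (h : IsProjection K p q) (hu : u ∈ K) :
    ‖q - u‖ ^ 2 ≤ ‖p - u‖ ^ 2 := by
  have h1 : ‖p - q‖ = ⨅ w : K, ‖p - w‖ := by
    have : Nonempty K := ⟨⟨q, h.1⟩⟩
    refine le_antisymm (le_ciInf fun w => h.2 w w.2) ?_
    exact ciInf_le ⟨0, by rintro _ ⟨w, rfl⟩; exact norm_nonneg _⟩ (⟨q, h.1⟩ : K)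
  have h2 := (norm_eq_iInf_iff_real_inner_le_zero hK h.1).1 h1 u hu
  have h3 : p - u = (p - q) - (u - q) := by abel
  have h4 : q - u = -(u - q) := by abel
  rw [h3, h4, norm_neg, norm_sub_sq_real (p - q)]
  nlinarith [sq_nonneg ‖p - q‖]

theorem sum_inner_le_of_isProjection {E : Type*} [NormedAddCommGroup E] [InnerProductSpace ℝ E]
    {K : Set E} (hK : Convex ℝ K) {x g : ℕ → E} {u : E} (hu : u ∈ K) {η G D : ℝ} (hη : 0 < η)
    {n : ℕ} (hn : 0 < n) (hg : ∀ k < n, ‖g k‖ ≤ G)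
    (hp : ∀ k, k + 1 < n → IsProjection K (x k - η • g k) (x (k + 1)))
    (hD : ∀ k < n, ‖x k - u‖ ≤ D) :
    ∑ k ∈ Finset.range n, inner ℝ (g k) (x k - u) ≤
      D ^ 2 / (2 * η) + n * η * G ^ 2 / 2 + G * D := by
  -- No projection follows the last round. The telescoping sum covers the first `m` rounds, and the
  -- last one is bounded separately by `G * D`.
  obtain ⟨m, rfl⟩ : ∃ m, n = m + 1 := ⟨n - 1, by omega⟩
  have key : ∀ j ≤ m, 2 * η * ∑ k ∈ Finset.range j, inner ℝ (g k) (x k - u) ≤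
      ‖x 0 - u‖ ^ 2 - ‖x j - u‖ ^ 2 + j * (η ^ 2 * G ^ 2) := by
    intro j
    induction j with
    | zero => simp
    | succ j ih =>
      intro hj
      have h1 := (hp j (by omega)).norm_sub_le hK hu
      rw [show x j - η • g j - u = (x j - u) - η • g j by abel, norm_sub_sq_real (x j - u),
        inner_smul_right, norm_smul, mul_pow, real_inner_comm (g j), Real.norm_eq_abs, sq_abs] at h1
      have h2 := pow_le_pow_left₀ (norm_nonneg _) (hg j (by omega)) 2
      have h3 := mul_le_mul_of_nonneg_left h2 (sq_nonneg η)
      rw [Finset.sum_range_succ, mul_add]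
      push_cast
      linarith [ih (by omega)]
  have h1 := key m le_rfl
  have h2 := pow_le_pow_left₀ (norm_nonneg _) (hD 0 (by omega)) 2
  have hG : 0 ≤ G := (norm_nonneg _).trans (hg 0 (by omega))
  have h3 : inner ℝ (g m) (x m - u) ≤ G * D := (real_inner_le_norm _ _).trans
    (mul_le_mul (hg m (by omega)) (hD m (by omega)) (norm_nonneg _) hG)
  rw [Finset.sum_range_succ]
  refine add_le_add ?_ h3
  have h4 : ∑ k ∈ Finset.range m, inner ℝ (g k) (x k - u) ≤
      (D ^ 2 + m * (η ^ 2 * G ^ 2)) / (2 * η) := by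
    rw [le_div_iff₀ (by positivity)]
    nlinarith [sq_nonneg ‖x m - u‖]
  refine h4.trans ?_
  rw [add_div]
  refine add_le_add le_rfl ?_
  rw [div_le_iff₀ (by positivity)]
  push_cast
  nlinarith [mul_nonneg (sq_nonneg η) (sq_nonneg G)]

/-! ### Convex quadratics -/

theorem IsConvexQuadratic.differentiable {f : Point d → ℝ} (hf : IsConvexQuadratic f) :
    Differentiable ℝ f := by
  obtain ⟨H, q, c, -, hfx⟩ := hf
  rw [show f = fun x => 1 / 2 * inner ℝ x (H x) + inner ℝ q x + c from funext hfx]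
  exact (((differentiable_id.inner ℝ H.differentiable).const_mul _).add
    ((differentiable_const q).inner ℝ differentiable_id)).add_const c

/-- The gradient is `H x + q`, and the two sides differ by half the nonnegative form `⟨x - y, H (x -
y)⟩`. -/
theorem IsConvexQuadratic.sub_le {f : Point d → ℝ} (hf : IsConvexQuadratic f) (x y : Point d) :
    f x - f y ≤ inner ℝ (gradient f x) (x - y) := by
  have hd := (hf.differentiable x).hasGradientAt
  obtain ⟨H, q, c, hH, hfx⟩ := hf
  have hg : HasGradientAt f (H x + q) x := by
    rw [show f = fun x => 1 / 2 * inner ℝ x (H x) + inner ℝ q x + c from funext hfx,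
      hasGradientAt_iff_hasFDerivAt]
    have h1 := ((((hasFDerivAt_id (𝕜 := ℝ) x).inner ℝ H.hasFDerivAt).const_mul (1 / 2)).add
      ((hasFDerivAt_const q x).inner ℝ (hasFDerivAt_id x))).add_const c
    refine h1.congr_fderiv ?_
    ext v
    have h2 : inner ℝ x (H v) = inner ℝ (H x) v := (hH.isSymmetric x v).symm
    simp only [id_eq, _root_.add_apply, FunLike.coe_smul, Pi.smul_apply,
      ContinuousLinearMap.comp_apply, ContinuousLinearMap.prod_apply, fderivInnerCLM_apply,
      ContinuousLinearMap.id_apply, _root_.zero_apply, inner_zero_left,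
      InnerProductSpace.toDual_apply_apply, inner_add_left, h2, real_inner_comm (H x) v, smul_eq_mul]
    ring
  rw [hd.unique hg, hfx, hfx]
  have h1 := hH.inner_nonneg_right (x - y)
  have h2 : inner ℝ y (H x) = inner ℝ x (H y) := by
    rw [real_inner_comm]; exact hH.isSymmetric x y
  simp only [map_sub, inner_sub_right, inner_sub_left, inner_add_left] at h1 ⊢
  rw [real_inner_comm (H x) x, real_inner_comm (H x) y] at *
  linarith

/-- Convexity makes this one-sided: only `x` has to be bounded. -/
theorem IsConvexQuadratic.sub_le_norm {f : Point d → ℝ} (hf : IsConvexQuadratic f) {β b D : ℝ}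
    (hβ : 0 ≤ β) (hgrad : ∀ x, ‖gradient f x‖ ≤ 2 * β * ‖x‖ + b) {x : Point d} (hx : ‖x‖ ≤ D)
    (y : Point d) : f x - f y ≤ (2 * β * D + b) * ‖x - y‖ := by
  refine (hf.sub_le x y).trans ((real_inner_le_norm _ _).trans ?_)
  have := hgrad x
  have : ‖gradient f x‖ ≤ 2 * β * D + b := by nlinarith
  gcongr

theorem gradient_const_mul {E : Type*} [NormedAddCommGroup E] [InnerProductSpace ℝ E]
    [CompleteSpace E] {f : E → ℝ} {x : E} (hf : DifferentiableAt ℝ f x) (c : ℝ) :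
    gradient (fun y => c * f y) x = c • gradient f x := by
  rw [gradient, gradient, fderiv_const_mul hf, map_smul]

/-- Gradient of a function precomposed with an affine map. -/
theorem hasGradientAt_comp_affine {E F : Type*} [NormedAddCommGroup E] [InnerProductSpace ℝ E]
    [CompleteSpace E] [NormedAddCommGroup F] [InnerProductSpace ℝ F] [CompleteSpace F]
    {f : F → ℝ} (hf : Differentiable ℝ f) (ℓ : E →L[ℝ] F) (c : F) (x : E) :
    HasGradientAt (fun y => f (ℓ y + c)) (ContinuousLinearMap.adjoint ℓ (gradient f (ℓ x + c))) x := by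
  rw [hasGradientAt_iff_hasFDerivAt]
  have h1 := (hf (ℓ x + c)).hasGradientAt.hasFDerivAt.comp x (ℓ.hasFDerivAt.add_const c)
  refine h1.congr_fderiv ?_
  ext v
  simp [ContinuousLinearMap.adjoint_inner_left]

/-! ### Boundedness of the trajectory -/

/-- Bernoulli gives `(1 + γ) ^ m ≥ 1 + m γ`, while `(1 + γ) ^ m * (1 - γ) ^ m ≤ 1`. -/
theorem pow_le_inv {γ : ℝ} (hγ : 0 < γ) (hγ1 : γ < 1) {m : ℕ} (hm : 1 ≤ m) :
    (1 - γ) ^ m ≤ (γ * m)⁻¹ := by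
  have hm' : (0 : ℝ) < m := by exact_mod_cast hm
  rw [le_inv_comm₀ (pow_pos (by linarith) m) (by positivity)]
  have h1 : 1 + (m : ℝ) * γ ≤ (1 + γ) ^ m := one_add_mul_le_pow (by linarith) m
  have h2 : (1 + γ) ^ m * (1 - γ) ^ m ≤ 1 := by
    rw [← mul_pow]
    exact pow_le_one₀ (by nlinarith) (by nlinarith)
  have h3 : (1 + γ) ^ m ≤ ((1 - γ) ^ m)⁻¹ := by
    rw [← one_div, le_div_iff₀ (pow_pos (by linarith) m)]; exact h2
  linarith

/-- Strong induction on time, with `U = κ ^ 5 * γ⁻¹ ^ 2` the gain from disturbances to states.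
Disturbances of size `20 U Q` give states of size `22 U ^ 2 Q`. The smallness of `e` and the size of
`L` turn this into ordinary disturbances of size `2 Q`. Before a reset only such disturbances have
acted for almost a whole episode, so the state is back to size `3 U Q`, and the new reset is again
within `20 U Q`. -/
theorem trajectory_bounds {A : ℕ → State d →L[ℝ] State d} {z w : ℕ → State d}
    {M : ℕ → Policy d L} {n T : ℕ} {κ γ e b Q : ℝ} (hA : SequentiallyStable A n κ γ)
    (hκ : 1 ≤ κ) (hγ : 0 < γ) (hγ1 : γ < 1) (hL : 1 ≤ L) (hTL : 10 * L ≤ T)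
    (hLbig : 1000 * κ ^ 8 * γ⁻¹ ^ 4 ≤ L) (hbQ : b ≤ Q) (hQ : 0 ≤ Q)
    (he : e ≤ 2 * γ / (1000 * κ ^ 5 * (L : ℝ) ^ 2))
    (hz0 : ‖z 0‖ ≤ 2 * Q)
    (hM : ∀ k < n, M k ∈ policySet d L κ γ)
    (hz : ∀ k, k + 1 < n → z (k + 1) = A k (z k) + inputMap (dfcControl (M k) w k) + w k)
    (hw : ∀ k, k + 1 < n → ¬ T ∣ k + 1 → ‖w k‖ ≤ e * ‖z k‖ + b)
    (hwr : ∀ k, k + 1 < n → T ∣ k + 1 →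
      ‖w k‖ ≤ 3 * (‖z k‖ + ‖dfcControl (M k) w k‖ + Q)) :
    ∀ k < n, ‖z k‖ ≤ 22 * (κ ^ 5 * γ⁻¹ ^ 2) ^ 2 * Q ∧
      (k + 1 < n → ‖w k‖ ≤ 20 * (κ ^ 5 * γ⁻¹ ^ 2) * Q) ∧
      (k + 1 < n → ¬ T ∣ k + 1 → ‖w k‖ ≤ 2 * Q) := by
  set U := κ ^ 5 * γ⁻¹ ^ 2 with hU
  have hκ0 : 0 < κ := by linarith
  have hγi : 1 ≤ γ⁻¹ := (one_le_inv₀ hγ).2 hγ1.le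
  have hγi0 : 0 < γ⁻¹ := by linarith
  have hκU : κ ^ 2 ≤ U := by
    have : κ ^ 2 ≤ κ ^ 5 := pow_le_pow_right₀ hκ (by norm_num)
    have : 1 ≤ γ⁻¹ ^ 2 := one_le_pow₀ hγi
    nlinarith [pow_pos hκ0 5]
  have hU1 : 1 ≤ U := (one_le_pow₀ hκ).trans hκU
  have hUU : U ≤ U ^ 2 := by nlinarith
  have hκ3U : κ ^ 3 * γ⁻¹ ≤ U := by
    have h1 : κ ^ 3 ≤ κ ^ 5 := pow_le_pow_right₀ hκ (by norm_num)
    have h2 : γ⁻¹ ≤ γ⁻¹ ^ 2 := by nlinarith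
    exact mul_le_mul h1 h2 hγi0.le (by positivity)
  have hLpos : (0 : ℝ) < L := by exact_mod_cast hL
  have hL1 : (1 : ℝ) ≤ L := by exact_mod_cast hL
  intro k
  induction k using Nat.strong_induction_on with
  | _ k ih =>
  intro hk
  have hwall : ∀ j < k, ‖w j‖ ≤ 20 * U * Q := fun j hj => (ih j hj (by omega)).2.1 (by omega)
  -- the state
  have hzk : ‖z k‖ ≤ 22 * U ^ 2 * Q := by
    have h1 := norm_recursion_le (y := z) (s := 0) (m := k)
      (v := fun j => inputMap (dfcControl (M j) w j) + w j)
      (B := κ ^ 3 * γ⁻¹ * (20 * U * Q)) hA hκ hγ hγ1 (by positivity) (by omega)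
      (fun j hj => by rw [hz j (by omega), add_assoc, zero_add])
      (fun j hj => (norm_add_le _ _).trans ((add_le_add_left (norm_inputMap_le _) _).trans
        (norm_dfcControl_add_le hκ hγ hγ1 (by positivity) (hM j (by omega))
          fun i hi _ => hwall i (by omega))))
    have h2 : (1 - γ) ^ k ≤ 1 := pow_le_one₀ (by linarith) (by linarith)
    have h3 : κ ^ 2 * (1 - γ) ^ k * ‖z 0‖ ≤ κ ^ 2 * 1 * (2 * Q) := by gcongr
    have h4 : κ ^ 2 * γ⁻¹ * (κ ^ 3 * γ⁻¹ * (20 * U * Q)) = 20 * U ^ 2 * Q := by rw [hU]; ring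
    have h5 : κ ^ 2 * Q ≤ U ^ 2 * Q :=
      mul_le_mul_of_nonneg_right (hκU.trans hUU) hQ
    linarith
  have hwk : k + 1 < n → ¬ T ∣ k + 1 → ‖w k‖ ≤ 2 * Q := by
    intro hk1 hT
    have h1 := hw k hk1 hT
    have h2 : e * ‖z k‖ ≤ 2 * γ / (1000 * κ ^ 5 * (L : ℝ) ^ 2) * (22 * U ^ 2 * Q) := by gcongr
    have h3 : 2 * γ / (1000 * κ ^ 5 * (L : ℝ) ^ 2) * (22 * U ^ 2 * Q) ≤ Q := by
      rw [div_mul_eq_mul_div, div_le_iff₀ (by positivity)]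
      have h4 : κ ^ 8 * γ⁻¹ ^ 4 ≤ (L : ℝ) ^ 2 := by
        have : 0 ≤ κ ^ 8 * γ⁻¹ ^ 4 := by positivity
        nlinarith
      have h5 : γ * U ^ 2 ≤ κ ^ 5 * (κ ^ 8 * γ⁻¹ ^ 4) := by
        have : γ * U ^ 2 = κ ^ 10 * (γ⁻¹ ^ 3) := by rw [hU]; field_simp
        rw [this, ← mul_assoc, ← pow_add]
        have h6 : κ ^ 10 ≤ κ ^ (5 + 8) := pow_le_pow_right₀ hκ (by norm_num)
        have h7 : γ⁻¹ ^ 3 ≤ γ⁻¹ ^ 4 := pow_le_pow_right₀ hγi (by norm_num)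
        gcongr
      have h6 : γ * U ^ 2 ≤ κ ^ 5 * (L : ℝ) ^ 2 :=
        h5.trans (mul_le_mul_of_nonneg_left h4 (by positivity))
      have h7 := mul_le_mul_of_nonneg_right h6 hQ
      have : 0 ≤ κ ^ 5 * (L : ℝ) ^ 2 * Q := by positivity
      linarith
    linarith
  refine ⟨hzk, fun hk1 => ?_, hwk⟩
  by_cases hT : T ∣ k + 1
  swap
  · have : Q ≤ U * Q := le_mul_of_one_le_left hQ hU1
    linarith [hwk hk1 hT, mul_nonneg (by linarith : (0 : ℝ) ≤ U) hQ]
  -- no reset influences the controls during the last `T - 1 - L` steps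
  have hTk : T ≤ k + 1 := Nat.le_of_dvd (by omega) hT
  have hclean : ∀ i, k + 1 < i + 1 + T → i < k → ‖w i‖ ≤ 2 * Q := by
    intro i hi hik
    refine (ih i hik (by omega)).2.2 (by omega) fun hdvd => ?_
    have h1 := (Nat.dvd_sub hT hdvd)
    have := Nat.le_of_dvd (by omega) h1
    omega
  have hu : ‖dfcControl (M k) w k‖ ≤ 2 * U * Q := by
    -- The reset `w k` has no bound yet. The control at time `k` does not see it, so it is replaced
    -- by `0`.
    have h1 := norm_dfcControl_add_le (w := Function.update w k 0) (k := k) hκ hγ hγ1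
      (by positivity : 0 ≤ 2 * Q) (hM k hk) (fun j hj hjL => by
        rcases hj.lt_or_eq with hj | rfl
        · rw [Function.update_of_ne (by omega)]
          exact hclean j (by omega) hj
        · simp [hQ])
    have h2 : dfcControl (M k) (Function.update w k 0) k = dfcControl (M k) w k := by
      refine Finset.sum_congr rfl fun l _ => ?_
      split_ifs with h
      · rw [Function.update_of_ne (by omega)]
      · rfl
    rw [h2] at h1
    have h3 := mul_le_mul_of_nonneg_right hκ3U (by positivity : 0 ≤ 2 * Q)
    linarith [norm_nonneg (Function.update w k 0 k)]
  -- Restart the recursion `T - 1 - L ≥ L` steps back. The old state is damped by `(γ * L)⁻¹`, and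
  -- the lower bound on `L` absorbs its extra factor `U`.
  have hzk' : ‖z k‖ ≤ 3 * U * Q := by
    obtain ⟨s, hs⟩ : ∃ s, k = s + (T - 1 - L) := ⟨k - (T - 1 - L), by omega⟩
    have h1 := norm_recursion_le (y := fun j => z (s + j)) (s := s) (m := T - 1 - L)
      (v := fun j => inputMap (dfcControl (M (s + j)) w (s + j)) + w (s + j))
      (B := κ ^ 3 * γ⁻¹ * (2 * Q)) hA hκ hγ hγ1 (by positivity) (by omega)
      (fun j hj => by
        show z (s + j + 1) = _
        rw [hz (s + j) (by omega), add_assoc])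
      (fun j hj => (norm_add_le _ _).trans ((add_le_add_left (norm_inputMap_le _) _).trans
        (norm_dfcControl_add_le hκ hγ hγ1 (by positivity) (hM _ (by omega))
          fun i hi hiL => hclean i (by omega) (by omega))))
    simp only [add_zero, ← hs] at h1
    have h2 : (1 - γ) ^ (T - 1 - L) ≤ (γ * (L : ℝ))⁻¹ :=
      (pow_le_pow_of_le_one (by linarith) (by linarith) (by omega)).trans (pow_le_inv hγ hγ1 hL)
    have h3 : ‖z s‖ ≤ 22 * U ^ 2 * Q := (ih s (by omega) (by omega)).1
    have h4 : κ ^ 2 * (1 - γ) ^ (T - 1 - L) * ‖z s‖ ≤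
        κ ^ 2 * (γ * (L : ℝ))⁻¹ * (22 * U ^ 2 * Q) := by gcongr
    have h5 : κ ^ 2 * γ⁻¹ * (κ ^ 3 * γ⁻¹ * (2 * Q)) = 2 * U * Q := by rw [hU]; ring
    have h6 : κ ^ 2 * (γ * (L : ℝ))⁻¹ * (22 * U ^ 2 * Q) ≤ U * Q := by
      have : κ ^ 2 * (γ * (L : ℝ))⁻¹ * (22 * U ^ 2 * Q) =
        (κ ^ 2 * γ⁻¹ * 22 * U) * (U * Q) / L := by rw [mul_inv]; field_simp
      rw [this, div_le_iff₀ hLpos, mul_comm (U * Q)]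
      gcongr
      have h7 : κ ^ 2 * γ⁻¹ * 22 * U = 22 * (κ ^ 7 * γ⁻¹ ^ 3) := by rw [hU]; ring
      have h8 : κ ^ 7 * γ⁻¹ ^ 3 ≤ κ ^ 8 * γ⁻¹ ^ 4 :=
        mul_le_mul (pow_le_pow_right₀ hκ (by norm_num)) (pow_le_pow_right₀ hγi (by norm_num))
          (by positivity) (by positivity)
      have : 0 ≤ κ ^ 8 * γ⁻¹ ^ 4 := by positivity
      linarith
    linarith
  -- `3 * (3 * U + 2 * U + 1) * Q ≤ 18 * U * Q`, since `1 ≤ U`.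
  have := hwr k hk1 hT
  have : Q ≤ U * Q := le_mul_of_one_le_left hQ hU1
  linarith

/-! ### Comparison of states -/

section Comparison

variable {A : ℕ → State d →L[ℝ] State d} {w : ℕ → State d} {n : ℕ} {κ γ W : ℝ}

theorem norm_evolve_le (hA : SequentiallyStable A n κ γ) (hκ : 1 ≤ κ) (hγ : 0 < γ) (hγ1 : γ < 1)
    (hW : 0 ≤ W) (hw : ∀ k, k + 1 < n → ‖w k‖ ≤ W) {M : Policy d L}
    (hM : M ∈ policySet d L κ γ) (z₀ : State d) {s m : ℕ} (hsm : s + m < n) :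
    ‖evolve A (dfcControl M w) w z₀ s m‖ ≤ κ ^ 2 * ‖z₀‖ + κ ^ 5 * γ⁻¹ ^ 2 * W := by
  have hγi0 : 0 < γ⁻¹ := inv_pos.2 hγ
  have h1 := norm_recursion_le (y := evolve A (dfcControl M w) w z₀ s) (s := s) (m := m)
    (v := fun j => inputMap (dfcControl M w (s + j)) + w (s + j))
    (B := κ ^ 3 * γ⁻¹ * W) hA hκ hγ hγ1 (by positivity) (by omega)
    (fun j hj => by rw [evolve, add_assoc])
    (fun j hj => (norm_add_le _ _).trans ((add_le_add_left (norm_inputMap_le _) _).trans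
      (norm_dfcControl_add_le hκ hγ hγ1 hW hM fun i hi _ => hw i (by omega))))
  have h2 : (1 - γ) ^ m ≤ 1 := pow_le_one₀ (by linarith) (by linarith)
  have h3 : κ ^ 2 * (1 - γ) ^ m * ‖z₀‖ ≤ κ ^ 2 * 1 * ‖z₀‖ := by gcongr
  rw [evolve] at h1
  refine h1.trans ((add_le_add_left h3 _).trans_eq (by ring))

/-- The policies are arbitrary, not only members of the policy set: this is what yields an operator
norm in `surrogate_loss`. -/
theorem norm_evolve_sub_evolve_le (hA : SequentiallyStable A n κ γ) (hκ : 1 ≤ κ) (hγ : 0 < γ)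
    (hγ1 : γ < 1) (hW : 0 ≤ W) (hw : ∀ k, k + 1 < n → ‖w k‖ ≤ W) (M M' : Policy d L)
    (z₀ : State d) {s m : ℕ} (hsm : s + m < n) :
    ‖evolve A (dfcControl M w) w z₀ s m - evolve A (dfcControl M' w) w z₀ s m‖ ≤
      κ ^ 2 * γ⁻¹ * (L * W * ‖M - M'‖) := by
  have h1 := norm_recursion_le (s := s) (m := m)
    (y := fun j => evolve A (dfcControl M w) w z₀ s j - evolve A (dfcControl M' w) w z₀ s j)
    (v := fun j => inputMap (dfcControl (M - M') w (s + j)))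
    (B := L * W * ‖M - M'‖) hA hκ hγ hγ1 (by positivity) (by omega)
    (fun j hj => by
      simp only [evolve, dfcControl_sub, inputMap_sub, map_sub]
      abel)
    (fun j hj => (norm_inputMap_le _).trans
      (norm_dfcControl_le hW _ fun i hi => hw i (by omega)))
  simpa [evolve] using h1

/-- Inputs coincide over the last `min L k` steps, so the difference evolves without input. -/
theorem norm_surrogateState_sub_dfcState_le (hA : SequentiallyStable A n κ γ) (hκ : 1 ≤ κ)
    (hγ : 0 < γ) (hγ1 : γ < 1) (M : Policy d L) (z₀ : State d) {k : ℕ} (hk : k < n) :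
    ‖surrogateState A w M k - dfcState A w z₀ M k‖ ≤
      κ ^ 2 * (1 - γ) ^ min L k * ‖dfcState A w z₀ M (k - L)‖ := by
  have h1 := norm_recursion_le (s := k - L) (m := min L k)
    (y := fun j => evolve A (dfcControl M w) w 0 (k - L) j - dfcState A w z₀ M (k - L + j))
    (v := fun _ => 0) (B := 0) hA hκ hγ hγ1 le_rfl (by omega)
    (fun j hj => by
      rw [dfcState, dfcState, ← add_assoc]
      simp only [evolve, map_sub, zero_add]
      abel)
    (fun j hj => by simp)
  have h2 : k - L + min L k = k := by omega
  simpa only [surrogateState, h2, evolve, add_zero, zero_sub, norm_neg, mul_zero] using h1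

/-- The difference of the two states is driven only by the controls of `M j - M k`. -/
theorem norm_sub_surrogateState_le (hA : SequentiallyStable A n κ γ) (hκ : 1 ≤ κ) (hγ : 0 < γ)
    (hγ1 : γ < 1) (hW : 0 ≤ W) (hw : ∀ k, k + 1 < n → ‖w k‖ ≤ W) {z : ℕ → State d}
    {M : ℕ → Policy d L}
    (hz : ∀ k, k + 1 < n → z (k + 1) = A k (z k) + inputMap (dfcControl (M k) w k) + w k)
    {k : ℕ} (hk : k < n) {ε : ℝ} (hε : 0 ≤ ε)
    (hM : ∀ j < k, k ≤ j + L → ‖M j - M k‖ ≤ ε) :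
    ‖z k - surrogateState A w (M k) k‖ ≤
      κ ^ 2 * (1 - γ) ^ min L k * ‖z (k - L)‖ + κ ^ 2 * γ⁻¹ * (L * W * ε) := by
  have h1 := norm_recursion_le (s := k - L) (m := min L k)
    (y := fun j => z (k - L + j) - evolve A (dfcControl (M k) w) w 0 (k - L) j)
    (v := fun j => inputMap (dfcControl (M (k - L + j) - M k) w (k - L + j)))
    (B := L * W * ε) hA hκ hγ hγ1 (by positivity) (by omega)
    (fun j hj => by
      simp only [evolve, ← add_assoc, map_sub, dfcControl_sub, inputMap_sub]
      rw [hz _ (by omega)]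
      abel)
    (fun j hj => (norm_inputMap_le _).trans
      ((norm_dfcControl_le hW _ fun i hi => hw i (by omega)).trans
        (mul_le_mul_of_nonneg_left (hM _ (by omega) (by omega)) (by positivity))))
  have h2 : k - L + min L k = k := by omega
  simpa only [surrogateState, h2, evolve, add_zero, sub_zero] using h1

/-! ### The surrogate losses -/

theorem exists_surrogateState_eq (A : ℕ → State d →L[ℝ] State d) (w : ℕ → State d) (k : ℕ) :
    ∃ (ℓ : Policy d L →L[ℝ] Point d) (c : Point d), ∀ M : Policy d L,
      block (surrogateState A w M k) 0 = ℓ M + c := by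
  obtain ⟨ℓ, hℓ⟩ := exists_evolve_eq (L := L) A w 0 (k - L) (min L k)
  exact ⟨(blockCLM d 0).comp ℓ,
    block (evolve A (dfcControl (0 : Policy d L) w) w 0 (k - L) (min L k)) 0, fun M => by rw [surrogateState, hℓ M]; rfl⟩

theorem differentiable_surrogate_loss (A : ℕ → State d →L[ℝ] State d) (w : ℕ → State d)
    {φ : Point d → ℝ} (hφ : Differentiable ℝ φ) (k : ℕ) :
    Differentiable ℝ (fun M : Policy d L => φ (block (surrogateState A w M k) 0)) := by
  obtain ⟨ℓ, c, hℓ⟩ := exists_surrogateState_eq (L := L) A w k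
  simp only [hℓ]
  exact hφ.comp (ℓ.differentiable.add_const c)

/-- With the surrogate iterate written `ℓ M + c`, the gradient is the adjoint of `ℓ` applied to
`∇φ`; `‖ℓ‖` is read off by comparing a policy with the zero policy. -/
theorem surrogate_loss (hA : SequentiallyStable A n κ γ) (hκ : 1 ≤ κ) (hγ : 0 < γ)
    (hγ1 : γ < 1) (hW : 0 ≤ W) (hw : ∀ k, k + 1 < n → ‖w k‖ ≤ W) {φ : Point d → ℝ}
    (hφ : IsConvexQuadratic φ) {G : ℝ} {k : ℕ} (hk : k < n) (M : Policy d L)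
    (hG : ‖gradient φ (block (surrogateState A w M k) 0)‖ ≤ G) :
    ‖gradient (fun M' : Policy d L => φ (block (surrogateState A w M' k) 0)) M‖ ≤
      κ ^ 2 * γ⁻¹ * (L * W) * G ∧
    ∀ M' : Policy d L, φ (block (surrogateState A w M k) 0) -
      φ (block (surrogateState A w M' k) 0) ≤
      inner ℝ (gradient (fun M' : Policy d L => φ (block (surrogateState A w M' k) 0)) M)
        (M - M') := by
  have hγi0 : 0 < γ⁻¹ := inv_pos.2 hγ
  obtain ⟨ℓ, c, hℓ⟩ := exists_surrogateState_eq (L := L) A w k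
  have hnorm : ‖ℓ‖ ≤ κ ^ 2 * γ⁻¹ * (L * W) := by
    refine ContinuousLinearMap.opNorm_le_bound _ (by positivity) fun v => ?_
    have h1 := norm_evolve_sub_evolve_le hA hκ hγ hγ1 hW hw v 0 0
      (s := k - L) (m := min L k) (by omega)
    have h2 : ℓ v = block (surrogateState A w v k - surrogateState A w (0 : Policy d L) k) 0 := by
      rw [block_sub, hℓ, hℓ, map_zero]; abel
    rw [h2]
    refine (norm_block_le _ _).trans (h1.trans_eq ?_)
    rw [sub_zero]; ring
  rw [hℓ] at hG
  simp only [hℓ]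
  have hgr := hasGradientAt_comp_affine hφ.differentiable ℓ c M
  refine ⟨?_, fun M' => ?_⟩
  · rw [hgr.gradient]
    refine ((ContinuousLinearMap.adjoint ℓ).le_opNorm _).trans ?_
    rw [LinearIsometryEquiv.norm_map]
    exact mul_le_mul hnorm hG (norm_nonneg _) (by positivity)
  · rw [hgr.gradient, ContinuousLinearMap.adjoint_inner_left]
    refine (hφ.sub_le _ _).trans_eq ?_
    rw [map_sub]; congr 1; abel

end Comparison

/-! ### Regret against a fixed policy -/

theorem sum_pow_min_le {γ : ℝ} (hγ : 0 < γ) (hγ1 : γ < 1) (L n : ℕ) :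
    ∑ k ∈ Finset.range n, (1 - γ) ^ min L k ≤ n * (1 - γ) ^ L + γ⁻¹ := by
  have : ∀ k ∈ Finset.range n, (1 - γ) ^ min L k ≤ (1 - γ) ^ L + (1 - γ) ^ k := by
    intro k _
    have h1 : 0 ≤ (1 - γ) ^ L := pow_nonneg (by linarith) _
    have h2 : 0 ≤ (1 - γ) ^ k := pow_nonneg (by linarith) _
    rcases min_choice L k with h | h <;> rw [h] <;> linarith
  refine (Finset.sum_le_sum this).trans ?_
  rw [Finset.sum_add_distrib]
  simpa using sum_pow_le hγ hγ1 n

/-- Regret of the gradient perturbation controller against a fixed policy, on bounded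
disturbances. -/
theorem regret_le {A : ℕ → State d →L[ℝ] State d} {z w : ℕ → State d} {M : ℕ → Policy d L}
    {φ : ℕ → Point d → ℝ} {n : ℕ} {κ γ β b η D W Dm : ℝ} (hn : 0 < n)
    (hA : SequentiallyStable A n κ γ) (hκ : 1 ≤ κ) (hγ : 0 < γ) (hγ1 : γ < 1)
    (hβ : 0 ≤ β) (hb : 0 ≤ b) (hη : 0 < η)
    (hφ : ∀ k < n, IsConvexQuadratic (φ k))
    (hgrad : ∀ k < n, ∀ x, ‖gradient (φ k) x‖ ≤ 2 * β * ‖x‖ + b)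
    (hD : ∀ k < n, ‖z k‖ ≤ D) (hW : 0 ≤ W) (hw : ∀ k, k + 1 < n → ‖w k‖ ≤ W)
    (hDW : κ ^ 5 * γ⁻¹ ^ 2 * W ≤ D)
    (hz : ∀ k, k + 1 < n → z (k + 1) = A k (z k) + inputMap (dfcControl (M k) w k) + w k)
    (hM : ∀ k < n, M k ∈ policySet d L κ γ)
    (hstep : ∀ k, k + 1 < n → IsProjection (policySet d L κ γ)
      (M k - η • gradient
        (fun M' : Policy d L => φ k (block (surrogateState A w M' k) 0)) (M k)) (M (k + 1)))
    {M' : Policy d L} (hM' : M' ∈ policySet d L κ γ) (hDm : ∀ k < n, ‖M k - M'‖ ≤ Dm)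
    {D' G GM : ℝ} (hD' : D' = 2 * κ ^ 2 * D) (hG : G = 2 * β * D' + b)
    (hGM : GM = κ ^ 2 * γ⁻¹ * (L * W) * G) :
    ∑ k ∈ Finset.range n, φ k (block (z k) 0) -
      ∑ k ∈ Finset.range n, φ k (block (dfcState A w (z 0) M' k) 0) ≤
    2 * G * κ ^ 2 * D' * (n * (1 - γ) ^ L + γ⁻¹) + n * (2 * η * L * GM ^ 2) +
      (Dm ^ 2 / (2 * η) + n * η * GM ^ 2 / 2 + GM * Dm) := by
  have hγi0 : 0 < γ⁻¹ := inv_pos.2 hγ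
  have hD0 : 0 ≤ D := (norm_nonneg _).trans (hD 0 hn)
  have hκ2 : 1 ≤ κ ^ 2 := one_le_pow₀ hκ
  -- `D'` is chosen to bound actual, surrogate and comparator states at once: the last are at most
  -- `κ ^ 2 * D + D`.
  have hDD' : D ≤ D' := by rw [hD']; nlinarith
  have hD'0 : 0 ≤ D' := hD0.trans hDD'
  have hG0 : 0 ≤ G := by rw [hG]; positivity
  have hGM0 : 0 ≤ GM := by rw [hGM]; positivity
  have hW5 : κ ^ 5 * γ⁻¹ ^ 2 * W ≤ D' := hDW.trans hDD'
  have hsur : ∀ M₀ ∈ policySet d L κ γ, ∀ k < n, ‖block (surrogateState A w M₀ k) 0‖ ≤ D' := by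
    intro M₀ hM₀ k hk
    have := norm_evolve_le hA hκ hγ hγ1 hW hw hM₀ 0 (s := k - L) (m := min L k) (by omega)
    rw [norm_zero, mul_zero, zero_add] at this
    exact (norm_block_le _ _).trans (this.trans hW5)
  have hdfc : ∀ k < n, ‖dfcState A w (z 0) M' k‖ ≤ D' := by
    intro k hk
    have h1 := norm_evolve_le hA hκ hγ hγ1 hW hw hM' (z 0) (s := 0) (m := k) (by omega)
    have h2 : κ ^ 2 * ‖z 0‖ ≤ κ ^ 2 * D := by gcongr; exact hD 0 hn
    rw [dfcState]
    nlinarith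
  have hball : ∀ k < n, ∀ x, ‖x‖ ≤ D' → ‖gradient (φ k) x‖ ≤ G := by
    intro k hk x hx
    refine (hgrad k hk x).trans ?_
    rw [hG]; gcongr
  set g : ℕ → Policy d L := fun k => gradient
    (fun M' : Policy d L => φ k (block (surrogateState A w M' k) 0)) (M k) with hg
  have hsl := fun k (hk : k < n) => surrogate_loss hA hκ hγ hγ1 hW hw (hφ k hk) hk (M k)
    (hball k hk _ (hsur _ (hM k hk) k hk))
  have hgn : ∀ k < n, ‖g k‖ ≤ GM := fun k hk => by rw [hGM]; exact (hsl k hk).1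
  -- consecutive policies are close
  have hmove : ∀ k, k + 1 < n → ‖M k - M (k + 1)‖ ≤ 2 * η * GM := by
    intro k hk
    -- `M k` itself competes in the projection, so the new policy is within `η * GM` of the
    -- unprojected point.
    have h1 := (hstep k hk).2 (M k) (hM k (by omega))
    have h2 : ‖η • g k‖ ≤ η * GM := by
      rw [norm_smul, Real.norm_of_nonneg hη.le]
      exact mul_le_mul_of_nonneg_left (hgn k (by omega)) hη.le
    rw [sub_sub_cancel_left, norm_neg] at h1
    have h3 : M k - M (k + 1) = (M k - η • g k - M (k + 1)) + η • g k := by abel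
    rw [h3]
    refine (norm_add_le _ _).trans ?_
    linarith
  have hmoves : ∀ i j, j + i < n → ‖M j - M (j + i)‖ ≤ i * (2 * η * GM) := by
    intro i
    induction i with
    | zero => simp
    | succ i ih =>
      intro j hj
      have h1 := ih j (by omega)
      have h2 := hmove (j + i) (by omega)
      have h3 : M j - M (j + (i + 1)) = (M j - M (j + i)) + (M (j + i) - M (j + i + 1)) := by
        rw [add_assoc]; abel
      rw [h3]
      refine (norm_add_le _ _).trans ?_
      push_cast
      linarith
  have hpow : ∀ k, 0 ≤ (1 - γ) ^ min L k := fun k => pow_nonneg (by linarith) _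
  -- Insert the surrogate losses at `M k` and at `M'`: `h1` and `h3` are truncation errors, `h4` is
  -- the linearized regret.
  have hterm : ∀ k ∈ Finset.range n, φ k (block (z k) 0) -
      φ k (block (dfcState A w (z 0) M' k) 0) ≤
      2 * G * κ ^ 2 * D' * (1 - γ) ^ min L k + 2 * η * L * GM ^ 2 +
        inner ℝ (g k) (M k - M') := by
    intro k hk
    rw [Finset.mem_range] at hk
    have h1 : φ k (block (z k) 0) - φ k (block (surrogateState A w (M k) k) 0) ≤
        G * (κ ^ 2 * (1 - γ) ^ min L k * D' + κ ^ 2 * γ⁻¹ * (L * W * (L * (2 * η * GM)))) := by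
      have h2 := (hφ k hk).sub_le_norm hβ (hgrad k hk)
        ((norm_block_le (z k) 0).trans ((hD k hk).trans hDD'))
        (block (surrogateState A w (M k) k) 0)
      rw [← hG, ← block_sub] at h2
      refine h2.trans (mul_le_mul_of_nonneg_left ((norm_block_le _ _).trans ?_) hG0)
      refine (norm_sub_surrogateState_le hA hκ hγ hγ1 hW hw hz hk
        (ε := L * (2 * η * GM)) (by positivity) fun j hj hjL => ?_).trans ?_
      · obtain ⟨i, rfl⟩ : ∃ i, k = j + i := ⟨k - j, by omega⟩
        refine (hmoves i j hk).trans ?_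
        have : (i : ℝ) ≤ L := by exact_mod_cast (by omega : i ≤ L)
        gcongr
      · have := hpow k
        gcongr
        exact (hD _ (by omega)).trans hDD'
    have h3 : φ k (block (surrogateState A w M' k) 0) -
        φ k (block (dfcState A w (z 0) M' k) 0) ≤
        G * (κ ^ 2 * (1 - γ) ^ min L k * D') := by
      have h2 := (hφ k hk).sub_le_norm hβ (hgrad k hk) (hsur M' hM' k hk)
        (block (dfcState A w (z 0) M' k) 0)
      rw [← hG, ← block_sub] at h2
      refine h2.trans (mul_le_mul_of_nonneg_left ((norm_block_le _ _).trans ?_) hG0)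
      refine (norm_surrogateState_sub_dfcState_le hA hκ hγ hγ1 M' (z 0) hk).trans ?_
      have := hpow k
      gcongr
      exact hdfc _ (by omega)
    have h4 := (hsl k hk).2 M'
    have h5 : G * (κ ^ 2 * γ⁻¹ * (L * W * (L * (2 * η * GM)))) = 2 * η * L * GM ^ 2 := by
      linear_combination (-(2 * η * L * GM)) * hGM
    rw [mul_add, h5] at h1
    linarith
  rw [← Finset.sum_sub_distrib]
  refine (Finset.sum_le_sum hterm).trans ?_
  rw [Finset.sum_add_distrib, Finset.sum_add_distrib, ← Finset.mul_sum]
  refine add_le_add (add_le_add ?_ (by simp))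
    (sum_inner_le_of_isProjection (convex_policySet κ γ) hM' hη hn hgn hstep hDm)
  exact mul_le_mul_of_nonneg_left (sum_pow_min_le hγ hγ1 L n) (by positivity)

/-! ### Normalization -/

section Normalization

variable {β κ γ : ℝ}

theorem betaZero_pos (hκ : 1 ≤ κ) (hγ : 0 < γ) (hγ1 : γ < 1) (hL : 1 ≤ L) :
    0 < betaZero κ γ L := by
  have : (0 : ℝ) < L := by exact_mod_cast hL
  have : 0 < 1 - γ := by linarith
  rw [betaZero]; positivity

theorem betaZero_le (hκ : 1 ≤ κ) (hγ : 0 < γ) (hγ1 : γ < 1) (L : ℕ) :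
    2 * betaZero κ γ L ≤ 2 * γ / (1000 * κ ^ 5 * (L : ℝ) ^ 2) := by
  have h1 : (1 - γ) ^ 2 ≤ 1 := pow_le_one₀ (by linarith) (by linarith)
  rw [betaZero, mul_div_assoc']
  have : 2 * (γ * (1 - γ) ^ 2) ≤ 2 * γ := by nlinarith
  norm_num1
  gcongr

theorem lossScale_pos (hκ : 1 ≤ κ) (hγ : 0 < γ) (hγ1 : γ < 1) (hL : 1 ≤ L) :
    0 < lossScale β κ γ L := by
  have h := betaZero_pos hκ hγ hγ1 hL
  rw [lossScale]
  split_ifs with hβ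
  · exact one_pos
  · exact div_pos h (by linarith)

theorem lossScale_le_one (hκ : 1 ≤ κ) (hγ : 0 < γ) (hγ1 : γ < 1) (hL : 1 ≤ L) :
    lossScale β κ γ L ≤ 1 := by
  have h := betaZero_pos hκ hγ hγ1 hL
  rw [lossScale]
  split_ifs with hβ
  · exact le_rfl
  · exact (div_le_one₀ (by linarith)).2 (by linarith)

theorem lossScale_mul_le (hκ : 1 ≤ κ) (hγ : 0 < γ) (hγ1 : γ < 1) (hL : 1 ≤ L) :
    lossScale β κ γ L * β ≤ betaZero κ γ L := by
  have h := betaZero_pos hκ hγ hγ1 hL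
  rw [lossScale]
  split_ifs with hβ
  · rwa [one_mul]
  · rw [div_mul_cancel₀ _ (by linarith)]

/-- The `(1 - γ) ^ 2` in `betaZero` cancels the numerator, leaving a polynomial in `γ⁻¹`. -/
theorem sq_div_lossScale_le (hβ : 0 ≤ β) (hκ : 1 ≤ κ) (hγ : 0 < γ) (hγ1 : γ < 1) (hL : 1 ≤ L) :
    (1 - γ) ^ 2 / lossScale β κ γ L ≤ 1 + 1000 * β * κ ^ 5 * (L : ℝ) ^ 2 * γ⁻¹ := by
  have hL0 : (0 : ℝ) < L := by exact_mod_cast hL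
  have h1 : 0 < 1 - γ := by linarith
  have h2 : (1 - γ) ^ 2 ≤ 1 := pow_le_one₀ (by linarith) (by linarith)
  have h3 : 0 ≤ 1000 * β * κ ^ 5 * (L : ℝ) ^ 2 * γ⁻¹ := by positivity
  rw [lossScale]
  split_ifs with h
  · rw [div_one]; linarith
  · have hβ0 : 0 < β := (betaZero_pos hκ hγ hγ1 hL).trans (not_le.1 h)
    have : (1 - γ) ^ 2 / (betaZero κ γ L / β) = 1000 * β * κ ^ 5 * (L : ℝ) ^ 2 * γ⁻¹ := by
      rw [betaZero]; field_simp; norm_num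
    linarith

end Normalization

/-! ### Total cost, existence of the minimum, size of the resets -/

theorem totalCost_eq_sum (N T : ℕ) (f : ℕ → ℕ → Point d → ℝ) (z : ℕ → State d) :
    totalCost N T f z = ∑ k ∈ Finset.range (N * T), f (k % T) (k / T) (block (z k) 0) := by
  rw [totalCost]
  induction N with
  | zero => simp
  | succ N ih =>
    rw [Finset.sum_range_succ, ih, Nat.succ_mul, Finset.sum_range_add]
    congr 1
    refine Finset.sum_congr rfl fun t ht => ?_
    rw [Finset.mem_range] at ht
    rw [Nat.add_comm (N * T) t, Nat.add_mul_mod_self_right, Nat.mod_eq_of_lt ht,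
      Nat.add_mul_div_right _ _ (by omega), Nat.div_eq_of_lt ht, zero_add]

theorem exists_isMinOn_totalCost {N T : ℕ} {κ γ : ℝ} {f : ℕ → ℕ → Point d → ℝ}
    (hκ : 1 ≤ κ) (hγ : 0 < γ) (hγ1 : γ < 1) (hf : ∀ i < N, ∀ t < T, Continuous (f t i))
    (A : ℕ → State d →L[ℝ] State d) (w : ℕ → State d) (z₀ : State d)
    (hne : (policySet d L κ γ).Nonempty) :
    ∃ M ∈ policySet d L κ γ,
      IsMinOn (fun M' : Policy d L => totalCost N T f (dfcState A w z₀ M'))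
        (policySet d L κ γ) M := by
  refine (isCompact_policySet hκ hγ hγ1).exists_isMinOn hne (Continuous.continuousOn ?_)
  refine continuous_finsetSum _ fun i hi => continuous_finsetSum _ fun t ht => ?_
  rw [Finset.mem_range] at hi ht
  refine (hf i hi t ht).comp ((blockCLM d 0).continuous.comp ?_)
  obtain ⟨ℓ, hℓ⟩ := exists_evolve_eq (L := L) A w z₀ 0 (i * T + t)
  exact (ℓ.continuous.add continuous_const).congr fun M => (hℓ M).symm

/-- With `e ≤ 1 / 3` the coefficients of `‖z‖` from the three blocks add up to `4/3 + 1 + 2/3 = 3`.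
-/
theorem norm_resetDisturbance_le {δ η e b R : ℝ} {F : ℕ → Point d → ℝ} {k : ℕ} {z u : State d}
    {x' : Point d} (hδ : 0 < δ) (hδ1 : δ ≤ 1 / 2) (hη : 0 < η) (hη1 : η ≤ 1) (he : e ≤ 1 / 3)
    (hR : 0 ≤ R)
    (hF : ∀ x, ‖gradient (F k) x‖ ≤ e * ‖x‖ + b)
    (hF' : ∀ x, ‖gradient (F (k - 1)) x‖ ≤ e * ‖x‖ + b) (hx' : ‖x'‖ ≤ R) :
    ‖resetDisturbance δ η F k z u x'‖ ≤ 3 * (‖z‖ + ‖u‖ + (R + b)) := by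
  have hb := norm_block_le z
  have hg : ∀ r, e * ‖block z r‖ ≤ 1 / 3 * ‖z‖ := fun r =>
    mul_le_mul he (hb r) (norm_nonneg _) (by norm_num)
  have h1 : ‖(1 - δ) • block z 0‖ ≤ ‖z‖ := by
    rw [norm_smul, Real.norm_of_nonneg (by linarith)]
    nlinarith [hb 0, norm_nonneg (block z 0)]
  have h2 : ‖η • gradient (F (k - 1)) (block z 1)‖ ≤ 1 / 3 * ‖z‖ + b := by
    rw [norm_smul, Real.norm_of_nonneg hη.le]
    have := hF' (block z 1)
    nlinarith [hg 1, norm_nonneg (gradient (F (k - 1)) (block z 1))]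
  have h3 := norm_sub_le x' ((1 - δ) • block z 0 - η • gradient (F (k - 1)) (block z 1) + block u 0)
  have h4 := norm_add_le ((1 - δ) • block z 0 - η • gradient (F (k - 1)) (block z 1)) (block u 0)
  have h5 := norm_sub_le ((1 - δ) • block z 0) (η • gradient (F (k - 1)) (block z 1))
  have h6 := norm_sub_le x' (block z 0)
  have h7 := norm_sub_le (gradient (F k) (block z 1)) (gradient (F k) (block z 0))
  refine (norm_mkState_le _ _ _).trans ?_
  linarith [hg 0, hg 1, hF (block z 0), hF (block z 1), norm_block_le u 0, norm_nonneg u, hb 0]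

theorem mul_pow_le_one {γ : ℝ} (hγ1 : γ < 1) {n : ℝ} (hn : 0 < n)
    (h : Real.log n ≤ γ * L) : n * (1 - γ) ^ L ≤ 1 := by
  have h1 : (1 - γ) ^ L ≤ Real.exp (-γ) ^ L :=
    pow_le_pow_left₀ (by linarith) (Real.one_sub_le_exp_neg γ) L
  have h2 : Real.exp (-γ) ^ L ≤ n⁻¹ := by
    rw [← Real.exp_nat_mul, ← Real.exp_log (inv_pos.2 hn), Real.log_inv, Real.exp_le_exp]
    linarith
  calc n * (1 - γ) ^ L ≤ n * n⁻¹ := by gcongr; exact h1.trans h2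
    _ = 1 := mul_inv_cancel₀ hn.ne'

set_option maxHeartbeats 1000000 in
/-- The explicit regret bound is polynomial in any common bound `V` of the parameters. -/
theorem regret_bound_le_pow {V n γi β κ Q b dr Lr ai a₂ s ηg a X Dm : ℝ} (hV : 1000 ≤ V)
    (hn : 1 ≤ √n) (hγi : 0 ≤ γi) (hγV : γi ≤ V) (hβ : 0 ≤ β) (hβV : β ≤ V) (hκ : 0 ≤ κ)
    (hκV : κ ≤ V) (hQ : 0 ≤ Q) (hQV : Q ≤ V) (hb : 0 ≤ b) (hbV : b ≤ V) (hd : 0 ≤ dr)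
    (hdV : dr ≤ V) (hL : 0 ≤ Lr) (hLV : Lr ≤ V) (haiV : ai ≤ V) (ha₂V : a₂ ≤ V)
    (hs : 0 < s) (hs1 : s ≤ 1) (hηg : 0 < ηg) (hηi : ηg⁻¹ ≤ ai * √n)
    (hnη : n * ηg ≤ a₂ * √n) (hn0 : 0 ≤ n)
    (ha : n * a ≤ 1) (ha0 : 0 ≤ a) (hX0 : 0 ≤ X) (hX : X ≤ 1)
    (hXs : X / s ≤ 1 + 1000 * β * κ ^ 5 * Lr ^ 2 * γi)
    (hDm0 : 0 ≤ Dm) (hDm : Dm ^ 2 = 12 * dr * Lr * κ ^ 6 * X)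
    {D W D' G GM : ℝ} (hD : D = 22 * (κ ^ 5 * γi ^ 2) ^ 2 * Q) (hW : W = 20 * (κ ^ 5 * γi ^ 2) * Q)
    (hD' : D' = 2 * κ ^ 2 * D) (hG : G = 2 * β * D' + b)
    (hGM : GM = κ ^ 2 * γi * (Lr * W) * G) :
    2 * G * κ ^ 2 * D' * (n * a + γi) + n * (2 * (ηg * s) * Lr * GM ^ 2) +
      (Dm ^ 2 / (2 * (ηg * s)) + n * (ηg * s) * GM ^ 2 / 2 + GM * Dm) ≤ V ^ 74 * √n := by
  have hV1 : 1 ≤ V := by linarith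
  have hV0 : 0 ≤ V := by linarith
  have hD0 : 0 ≤ D := by rw [hD]; positivity
  have hW0 : 0 ≤ W := by rw [hW]; positivity
  have hD'0 : 0 ≤ D' := by rw [hD']; positivity
  have hG0 : 0 ≤ G := by rw [hG]; positivity
  have hGM0 : 0 ≤ GM := by rw [hGM]; positivity
  have c2 : 2 ≤ V := by linarith
  have c22 : 22 ≤ V := by linarith
  have c20 : 20 ≤ V := by linarith
  have c12 : 12 ≤ V := by linarith
  have hDV : D ≤ V ^ 16 := by
    rw [hD]
    calc _ ≤ V * (V ^ 5 * V ^ 2) ^ 2 * V := by gcongr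
      _ = V ^ 16 := by ring
  have hWV : W ≤ V ^ 9 := by
    rw [hW]
    calc _ ≤ V * (V ^ 5 * V ^ 2) * V := by gcongr
      _ = V ^ 9 := by ring
  have hD'V : D' ≤ V ^ 19 := by
    rw [hD']
    calc _ ≤ V * V ^ 2 * V ^ 16 := by gcongr
      _ = V ^ 19 := by ring
  have hGV : G ≤ V ^ 22 := by
    rw [hG]
    calc _ ≤ V * V * V ^ 19 + V := by gcongr
      _ ≤ V ^ 21 + V ^ 21 := by
        refine add_le_add (by ring_nf; rfl) (le_self_pow₀ hV1 (by norm_num))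
      _ = 2 * V ^ 21 := by ring
      _ ≤ V * V ^ 21 := by gcongr
      _ = V ^ 22 := by ring
  have hGMV : GM ≤ V ^ 35 := by
    rw [hGM]
    calc _ ≤ V ^ 2 * V * (V * V ^ 9) * V ^ 22 := by gcongr
      _ = V ^ 35 := by ring
  have hDmV : Dm ≤ V ^ 5 := by
    refine abs_le_of_sq_le_sq' ?_ (by positivity) |>.2
    rw [hDm]
    calc _ ≤ V * V * V * V ^ 6 * 1 := by gcongr
      _ = V ^ 9 := by ring
      _ ≤ V ^ 10 := pow_le_pow_right₀ hV1 (by norm_num)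
      _ = (V ^ 5) ^ 2 := by ring
  have hnηs : n * (ηg * s) ≤ V * √n := by
    calc n * (ηg * s) = n * ηg * s := by ring
      _ ≤ n * ηg * 1 := by gcongr
      _ ≤ a₂ * √n := by linarith
      _ ≤ V * √n := by gcongr
  have t1 : 2 * G * κ ^ 2 * D' * (n * a + γi) ≤ V ^ 73 * √n := by
    have : n * a + γi ≤ V ^ 2 := by nlinarith
    calc _ ≤ V * V ^ 22 * V ^ 2 * V ^ 19 * V ^ 2 := by gcongr
      _ = V ^ 46 * 1 := by ring
      _ ≤ V ^ 73 * √n := by gcongr; norm_num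
  -- The dominant term, due to the movement of the policies; it fixes the exponent.
  have t2 : n * (2 * (ηg * s) * Lr * GM ^ 2) ≤ V ^ 73 * √n := by
    calc _ = n * (ηg * s) * (2 * Lr * GM ^ 2) := by ring
      _ ≤ V * √n * (V * V * (V ^ 35) ^ 2) := by gcongr
      _ = V ^ 73 * √n := by ring
  have t3 : Dm ^ 2 / (2 * (ηg * s)) ≤ V ^ 73 * √n := by
    have h1 : X / s ≤ V ^ 11 := by
      refine hXs.trans ?_
      calc _ ≤ 1 + V * V * V ^ 5 * V ^ 2 * V := by gcongr
        _ = 1 + V ^ 10 := by ring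
        _ ≤ V ^ 10 + V ^ 10 := by gcongr; exact one_le_pow₀ hV1
        _ = 2 * V ^ 10 := by ring
        _ ≤ V * V ^ 10 := by gcongr
        _ = V ^ 11 := by ring
    have h2 : 0 ≤ X / s := by positivity
    have h3 : ηg⁻¹ ≤ V * √n := hηi.trans (by gcongr)
    have h4 : 0 ≤ ηg⁻¹ := by positivity
    rw [hDm]
    calc _ = 6 * dr * Lr * κ ^ 6 * (X / s) * ηg⁻¹ := by field_simp; ring
      _ ≤ V * V * V * V ^ 6 * V ^ 11 * (V * √n) := by gcongr; linarith
      _ = V ^ 21 * √n := by ring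
      _ ≤ V ^ 73 * √n := by gcongr; norm_num
  have t4 : n * (ηg * s) * GM ^ 2 / 2 ≤ V ^ 73 * √n := by
    have : 0 ≤ n * (ηg * s) * GM ^ 2 := by positivity
    calc _ ≤ n * (ηg * s) * GM ^ 2 := by linarith
      _ ≤ V * √n * (V ^ 35) ^ 2 := by gcongr
      _ = V ^ 71 * √n := by ring
      _ ≤ V ^ 73 * √n := by gcongr; norm_num
  have t5 : GM * Dm ≤ V ^ 73 * √n := by
    calc _ ≤ V ^ 35 * V ^ 5 := by gcongr
      _ = V ^ 40 * 1 := by ring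
      _ ≤ V ^ 73 * √n := by gcongr; norm_num
  have t6 : 5 * (V ^ 73 * √n) ≤ V ^ 74 * √n := by
    calc _ ≤ V * (V ^ 73 * √n) := by gcongr; linarith
      _ = V ^ 74 * √n := by ring
  linarith

end MetaOpt

/-! ### The main theorem -/

open MetaOpt in
set_option maxHeartbeats 1000000 in
theorem mainTheorem1 :
    ∃ (PL : MvPolynomial (Fin 6) ℝ) (P : MvPolynomial (Fin 9) ℝ) (q : ℕ),
      ∀ (d N T L : ℕ) (β b R κ γ δ η ηg a₁ a₂ Λ : ℝ)
        (f : ℕ → ℕ → MetaOpt.Point d → ℝ) (x₁ : ℕ → MetaOpt.Point d)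
        (z w : ℕ → MetaOpt.State d) (M : ℕ → MetaOpt.Policy d L),
      0 < N → 1 ≤ L → 10 * L ≤ T →
      0 ≤ β → 0 ≤ b → 1 ≤ κ → 0 < γ → γ < 1 →
      0 < δ → δ ≤ 1 / 2 → 0 < η → η ≤ 1 →
      -- the losses are convex quadratic, with gradients of at most linear growth
      (∀ i < N, ∀ t < T, MetaOpt.IsConvexQuadratic (f t i)) →
      (∀ i < N, ∀ t < T, ∀ x, ‖gradient (f t i) x‖ ≤ 2 * β * ‖x‖ + b) →
      -- bounded resets
      (∀ i < N, ‖x₁ i‖ ≤ R) →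
      -- sequential stability of the system
      MetaOpt.SequentiallyStable
        (MetaOpt.dynamics δ η (MetaOpt.normalizedLoss T L β κ γ f)) (N * T) κ γ →
      -- `L = Θ(log NT)` and `η_g = Θ(1 / √(NT))`
      MvPolynomial.eval ![γ⁻¹, β, κ, R, b, (d : ℝ)] PL * Real.log (N * T) ≤ L →
      (L : ℝ) ≤ Λ * Real.log (N * T) →
      0 < a₁ → a₁ / √(N * T) ≤ ηg → ηg ≤ a₂ / √(N * T) →
      MetaOpt.IsGPCRun N T δ η ηg κ γ x₁ (MetaOpt.normalizedLoss T L β κ γ f) z w M →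
      ∃ Mstar ∈ MetaOpt.policySet d L κ γ,
        IsMinOn
          (fun M' : MetaOpt.Policy d L => MetaOpt.totalCost N T f
            (MetaOpt.dfcState
              (MetaOpt.dynamics δ η (MetaOpt.normalizedLoss T L β κ γ f)) w (z 0) M'))
          (MetaOpt.policySet d L κ γ) Mstar ∧
        MetaOpt.totalCost N T f z -
          MetaOpt.totalCost N T f
            (MetaOpt.dfcState
              (MetaOpt.dynamics δ η (MetaOpt.normalizedLoss T L β κ γ f)) w (z 0) Mstar) ≤
          MvPolynomial.eval ![γ⁻¹, β, κ, R, b, (d : ℝ), Λ, a₁⁻¹, a₂] P *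
            Real.log (N * T) ^ q * √(N * T) := by
  -- The first polynomial is `1000 γ⁻⁴ κ⁸`; as `log n ≥ 1`, it yields both `hLbig` and `hlogL`. The
  -- second and the exponent come from `V ^ 74` with `V = 1000 * S * log n`.
  refine ⟨MvPolynomial.C 1000 * MvPolynomial.X 0 ^ 4 * MvPolynomial.X 2 ^ 8,
    (MvPolynomial.C 1000 * (1 + ∑ i, MvPolynomial.X i)) ^ 74, 74, ?_⟩
  intro d N T L β b R κ γ δ η ηg a₁ a₂ Λ f x₁ z w M hN hL hTL hβ hb hκ hγ hγ1 hδ hδ1 hη hη1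
    hquad hgrad hx₁ hA hPL hΛ ha₁ hηg1 hηg2 hrun
  have hT : 0 < T := by omega
  have hn10 : 10 ≤ N * T := by
    calc 10 ≤ 1 * T := by omega
      _ ≤ N * T := Nat.mul_le_mul_right T hN
  have hcast : (N : ℝ) * T = ((N * T : ℕ) : ℝ) := by push_cast; rfl
  rw [hcast] at hPL hΛ hηg1 hηg2 ⊢
  set n := N * T with hn
  set F := normalizedLoss T L β κ γ f with hF
  set A := dynamics δ η F with hAdef
  set s := lossScale β κ γ L with hs
  -- elementary facts about the parameters
  have hnR : (10 : ℝ) ≤ n := by exact_mod_cast hn10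
  have hn0 : (0 : ℝ) < n := by linarith
  have hγi : 1 ≤ γ⁻¹ := (one_le_inv₀ hγ).2 hγ1.le
  have hR : 0 ≤ R := (norm_nonneg _).trans (hx₁ 0 hN)
  have hL0 : (0 : ℝ) < L := by exact_mod_cast hL
  have hL1 : (1 : ℝ) ≤ L := by exact_mod_cast hL
  have hlog : 1 ≤ Real.log n := by
    rw [Real.le_log_iff_exp_le hn0]
    linarith [Real.exp_one_lt_d9]
  have hsqrt : 1 ≤ √(n : ℝ) := Real.one_le_sqrt.2 (by linarith)
  have hsqrt0 : 0 < √(n : ℝ) := by linarith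
  simp only [map_mul, map_pow, MvPolynomial.eval_C, MvPolynomial.eval_X, Matrix.cons_val] at hPL
  have hκ8 : 1 ≤ κ ^ 8 := one_le_pow₀ hκ
  have hLbig : 1000 * κ ^ 8 * γ⁻¹ ^ 4 ≤ L := by
    refine le_trans ?_ hPL
    have : 0 ≤ 1000 * κ ^ 8 * γ⁻¹ ^ 4 := by positivity
    nlinarith
  have hlogL : Real.log n ≤ γ * L := by
    have h1 : γ⁻¹ ≤ 1000 * γ⁻¹ ^ 4 * κ ^ 8 := by
      have h2 : γ⁻¹ ≤ γ⁻¹ ^ 4 := le_self_pow₀ hγi (by norm_num)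
      have h3 : 0 ≤ γ⁻¹ ^ 4 := by positivity
      nlinarith [mul_nonneg h3 (by linarith : 0 ≤ κ ^ 8 - 1)]
    have h4 : γ⁻¹ * Real.log n ≤ L := le_trans (by gcongr) hPL
    rwa [inv_mul_le_iff₀ hγ] at h4
  have hs0 : 0 < s := lossScale_pos hκ hγ hγ1 hL
  have hs1 : s ≤ 1 := lossScale_le_one hκ hγ hγ1 hL
  have hηg0 : 0 < ηg := lt_of_lt_of_le (by positivity) hηg1
  -- Positivity of `a₂` and `Λ` is forced by the step size and by `L`; it makes the sum `S` dominate
  -- each of its terms.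
  have ha₂ : 0 < a₂ := by
    by_contra! h
    exact absurd (hηg0.trans_le hηg2) (not_lt.2 (div_nonpos_of_nonpos_of_nonneg h hsqrt0.le))
  have hΛ0 : 0 < Λ := by
    by_contra! h
    nlinarith [mul_nonneg_of_nonpos_of_nonpos h (by linarith : -Real.log n ≤ 0)]
  -- losses along the time line
  have hidx : ∀ k < n, k / T < N ∧ k % T < T := fun k hk =>
    ⟨(Nat.div_lt_iff_lt_mul hT).2 hk, Nat.mod_lt k hT⟩
  set φ : ℕ → Point d → ℝ := fun k x => f (k % T) (k / T) x with hφdef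
  have hφ : ∀ k < n, IsConvexQuadratic (φ k) := fun k hk =>
    hquad _ (hidx k hk).1 _ (hidx k hk).2
  have hφgrad : ∀ k < n, ∀ x, ‖gradient (φ k) x‖ ≤ 2 * β * ‖x‖ + b := fun k hk =>
    hgrad _ (hidx k hk).1 _ (hidx k hk).2
  have he0 : 0 ≤ 2 * betaZero κ γ L := by linarith [betaZero_pos hκ hγ hγ1 hL]
  have he := betaZero_le hκ hγ hγ1 L
  have hFgrad : ∀ k < n, ∀ x, ‖gradient (F k) x‖ ≤ 2 * betaZero κ γ L * ‖x‖ + b := by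
    intro k hk x
    have h1 : gradient (F k) x = s • gradient (φ k) x :=
      gradient_const_mul ((hφ k hk).differentiable x) s
    rw [h1, norm_smul, Real.norm_of_nonneg hs0.le]
    have h2 := mul_le_mul_of_nonneg_left (hφgrad k hk x) hs0.le
    have h3 := mul_le_mul_of_nonneg_right (lossScale_mul_le (β := β) hκ hγ hγ1 hL) (norm_nonneg x)
    have h4 : s * b ≤ b := mul_le_of_le_one_left hb hs1
    linarith
  have he3 : 2 * betaZero κ γ L ≤ 1 / 3 := by
    refine he.trans ?_
    rw [div_le_iff₀ (by positivity)]
    have : 1 ≤ κ ^ 5 * (L : ℝ) ^ 2 := one_le_mul_of_one_le_of_one_le (one_le_pow₀ hκ)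
      (one_le_pow₀ hL1)
    linarith
  -- the run
  have hM : ∀ k < n, M k ∈ policySet d L κ γ := by
    intro k hk
    cases k with
    | zero => exact hrun.policy_zero
    | succ k => exact (hrun.policy_succ k hk).1
  have hz0 : ‖z 0‖ ≤ 2 * (R + b) := by
    rw [hrun.state_zero]
    refine (norm_mkState_le _ _ _).trans ?_
    rw [norm_zero]
    linarith [hx₁ 0 hN]
  have hbounds := trajectory_bounds (b := b) (Q := R + b) hA hκ hγ hγ1 hL hTL hLbig (by linarith)
    (by linarith) he hz0 hM hrun.state_succ
    (fun k hk hTk => by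
      rw [hrun.disturbance k hk hTk]
      refine (norm_mkState_le _ _ _).trans ?_
      rw [norm_zero, zero_add, zero_add]
      refine (hFgrad k (by omega) _).trans ?_
      gcongr
      exact norm_block_le _ _)
    (fun k hk hTk => by
      have h1 := norm_resetDisturbance_le (z := z k) (u := dfcControl (M k) w k) hδ hδ1 hη hη1 he3
        hR (hFgrad k (by omega)) (hFgrad (k - 1) (by omega)) (hx₁ ((k + 1) / T) (hidx _ hk).1)
      rwa [← hrun.disturbance_reset k hk hTk] at h1)
  obtain ⟨Mstar, hMstar, hmin⟩ := exists_isMinOn_totalCost hκ hγ hγ1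
    (fun i hi t ht => (hquad i hi t ht).differentiable.continuous) A w (z 0)
    ⟨M 0, hrun.policy_zero⟩
  refine ⟨Mstar, hMstar, hmin, ?_⟩
  have hX := sq_div_lossScale_le (L := L) hβ hκ hγ hγ1 hL
  -- A step `ηg` on the normalized loss is a step `ηg * s` on the original one.
  have hreg := regret_le (φ := φ) (η := ηg * s) (Dm := √(12 * d * L * κ ^ 6 * (1 - γ) ^ 2))
    (by omega) hA hκ hγ hγ1 hβ hb (by positivity) hφ hφgrad (fun k hk => (hbounds k hk).1)
    (by positivity) (fun k hk => (hbounds k (by omega)).2.1 hk)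
    (by nlinarith [mul_nonneg (sq_nonneg (κ ^ 5 * γ⁻¹ ^ 2)) (by linarith : 0 ≤ R + b)])
    hrun.state_succ hM
    (fun k hk => by
      have h1 := hrun.policy_succ k hk
      have h2 := gradient_const_mul
        (differentiable_surrogate_loss A w (hφ k (by omega)).differentiable k (M k)) s
      rw [mul_smul, ← h2]
      exact h1)
    hMstar
    (fun k hk => Real.le_sqrt_of_sq_le (norm_sub_sq_le_of_mem_policySet hκ hγ hγ1 (hM k hk) hMstar))
    rfl rfl rfl
  rw [totalCost_eq_sum, totalCost_eq_sum]
  refine hreg.trans ?_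
  set S : ℝ := 1 + (γ⁻¹ + β + κ + R + b + d + Λ + a₁⁻¹ + a₂) with hS
  have hd : (0 : ℝ) ≤ d := Nat.cast_nonneg d
  have ha₁i : 0 < a₁⁻¹ := inv_pos.2 ha₁
  have hS1 : 1 ≤ S := by rw [hS]; linarith
  have hSl : S ≤ S * Real.log n := le_mul_of_one_le_right (by linarith) hlog
  have hLS : L ≤ S * Real.log n := hΛ.trans (by
    refine mul_le_mul_of_nonneg_right ?_ (by linarith)
    rw [hS]; linarith)
  have hSV : ∀ x ≤ S, x ≤ 1000 * S * Real.log n := fun x hx => by linarith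
  refine (regret_bound_le_pow (V := 1000 * S * Real.log n) (ai := a₁⁻¹) (a₂ := a₂)
    (by linarith) hsqrt (by linarith)
    (hSV _ (by rw [hS]; linarith)) hβ (hSV _ (by rw [hS]; linarith)) (by linarith)
    (hSV _ (by rw [hS]; linarith)) (by linarith : 0 ≤ R + b) (hSV _ (by rw [hS]; linarith)) hb
    (hSV _ (by rw [hS]; linarith)) hd (hSV _ (by rw [hS]; linarith)) hL0.le (by linarith)
    (hSV _ (by rw [hS]; linarith)) (hSV _ (by rw [hS]; linarith)) hs0 hs1 hηg0
    ?_ ?_ hn0.le (mul_pow_le_one hγ1 hn0 hlogL) (pow_nonneg (by linarith) L) (sq_nonneg (1 - γ))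
    (pow_le_one₀ (by linarith) (by linarith)) hX (Real.sqrt_nonneg _)
    (Real.sq_sqrt (by positivity)) rfl rfl rfl rfl rfl).trans_eq ?_
  · refine (inv_anti₀ (by positivity) hηg1).trans_eq ?_
    rw [inv_div, div_eq_mul_inv, mul_comm]
  · calc (n : ℝ) * ηg ≤ n * (a₂ / √(n : ℝ)) := by gcongr
      _ = a₂ * √(n : ℝ) := by
        rw [mul_div_assoc', div_eq_iff hsqrt0.ne', mul_assoc, Real.mul_self_sqrt hn0.le, mul_comm]
  · have hsum : MvPolynomial.eval ![γ⁻¹, β, κ, R, b, (d : ℝ), Λ, a₁⁻¹, a₂]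
        ((MvPolynomial.C 1000 * (1 + ∑ i, MvPolynomial.X i)) ^ 74) = (1000 * S) ^ 74 := by
      simp only [map_pow, map_mul, map_add, map_one, map_sum, MvPolynomial.eval_C,
        MvPolynomial.eval_X]
      congr 2
      simp [Fin.sum_univ_succ, hS]
      ring
    rw [hsum, mul_pow (1000 * S)]
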